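/- Let $B$ be a von Neumann algebra with a faithful normal tracial state $\tau$. Let $B\langle X\rangle$ be the $*$-algebra of noncommutative polynomials over $B$ in one variable $X=X^*$ (the complex unital algebra spanned by the monomials $b_0Xb_1X\cdots Xb_n$, where $X$ satisfies no relation with $B$ except that it commutes with scalars). Let $\Sigma_0$ be the set of linear maps $\mu:B\langle X\rangle\to B$ that are unital ($\mu(1)=1$), $B$-bimodular ($\mu(bPc)=b\mu(P)c$ for $b,c\in B$), completely positive (for all $P_1,\dots,P_n\in B\langle X\rangle$ the matrix $[\mu(P_i^*P_j)]_{i,j}$ is positive in $M_n(B)$), and exponentially bounded by some $M\in\mathbb R$, that is $$\|\mu(Xb_1X\cdots Xb_nX)\|\le M^{n+1}\|b_1\|\cdots\|b_n\|\qquad\text{for all } n\ge 0,\ b_1,\dots,b_n\in B.$$ A tracial $W^*$-probability space over $(B,\tau)$ is a von Neumann algebra $A$ with a faithful normal tracial state that contains $B$ as a unital von Neumann subalgebra on which its trace restricts to $\tau$, together with the trace-preserving conditional expectation $E_B:A\to B$. Let $\Sigma_0^\tau$ be the set of $\mu\in\Sigma_0$ for which there are a tracial $W^*$-probability space $(A,E_B,B)$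 over $(B,\tau)$ and a self-adjoint $a\in A$ with $\mu(P)=E_B(P(a))$ for all $P\in B\langle X\rangle$. Theorem. Let $\mu\in\Sigma_0$. For $M\in\mathbb R$ consider the conditions 1. $\tau(\mu(P^*XP))\le M\,\tau(\mu(P^*P))$ for all $P\in B\langle X\rangle$; 2. $|\tau(\mu(P^*Q))|^2\le\tau(\mu(P^*P))\,\tau(\mu(Q^*Q))$ for all $P,Q\in B\langle X\rangle$; 3. $\tau(\mu(PQ))=\tau(\mu(QP))$ for all $P,Q\in B\langle X\rangle$. Then $\mu\in\Sigma_0^\tau$ if and only if (1) for some $M\in\mathbb R$, (2) and (3) hold. Moreover, for every $M$ by which $\mu$ is exponentially bounded, $\mu\in\Sigma_0^\tau$ if and only if (1) with this $M$, (2) and (3) hold. -/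

import Mathlib

open scoped ComplexOrder

universe u v

/-! ### Noncommutative polynomials `R⟨X⟩` over a complex unital `*`-algebra `R` -/

/-- The relations on the free complex algebra on the letters `some r` (`r ∈ R`) and `none` (the
variable `X`) which make `r ↦ some r` a homomorphism of unital complex algebras. -/
inductive NCPoly.Rel (R : Type u) [Ring R] [Algebra ℂ R] :
    FreeAlgebra ℂ (Option R) → FreeAlgebra ℂ (Option R) → Prop
  | add (a b : R) : NCPoly.Rel R (FreeAlgebra.ι ℂ (some (a + b)))
      (FreeAlgebra.ι ℂ (some a) + FreeAlgebra.ι ℂ (some b))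
  | smul (c : ℂ) (a : R) : NCPoly.Rel R (FreeAlgebra.ι ℂ (some (c • a)))
      (c • FreeAlgebra.ι ℂ (some a))
  | mul (a b : R) : NCPoly.Rel R (FreeAlgebra.ι ℂ (some (a * b)))
      (FreeAlgebra.ι ℂ (some a) * FreeAlgebra.ι ℂ (some b))
  | one : NCPoly.Rel R (FreeAlgebra.ι ℂ (some 1)) 1

/-- `R⟨X⟩`: the complex algebra generated by the algebra `R` and one variable `X` which satisfies
no relation with `R` other than commuting with the scalars, that is, the algebraic free product of
`R` and `ℂ[X]`. It is spanned by the monomials `r₀ X r₁ X ⋯ X rₙ`. -/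
def NCPoly (R : Type u) [Ring R] [Algebra ℂ R] : Type u := RingQuot (NCPoly.Rel R)

namespace NCPoly

section Basic

variable (R : Type u) [Ring R] [Algebra ℂ R]

noncomputable instance : Ring (NCPoly R) := inferInstanceAs (Ring (RingQuot (NCPoly.Rel R)))

noncomputable instance : Algebra ℂ (NCPoly R) :=
  inferInstanceAs (Algebra ℂ (RingQuot (NCPoly.Rel R)))

/-- The quotient map from the free algebra. -/
noncomputable def mk : FreeAlgebra ℂ (Option R) →ₐ[ℂ] NCPoly R :=
  RingQuot.mkAlgHom ℂ (NCPoly.Rel R)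

variable {R}

theorem mk_rel {x y : FreeAlgebra ℂ (Option R)} (h : NCPoly.Rel R x y) : mk R x = mk R y :=
  RingQuot.mkAlgHom_rel ℂ h

theorem mk_surjective : Function.Surjective (mk R) :=
  RingQuot.mkAlgHom_surjective ℂ (NCPoly.Rel R)

/-- The constant polynomials. -/
noncomputable def C : R →ₐ[ℂ] NCPoly R :=
  AlgHom.ofLinearMap
    { toFun := fun r => mk R (FreeAlgebra.ι ℂ (some r))
      map_add' := fun a b => by rw [mk_rel (Rel.add a b), map_add]
      map_smul' := fun c a => by rw [mk_rel (Rel.smul c a), map_smul]; rfl }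
    (by simpa using mk_rel (Rel.one (R := R)))
    (fun a b => by simpa using mk_rel (Rel.mul a b))

/-- The variable. -/
noncomputable def X : NCPoly R := mk R (FreeAlgebra.ι ℂ none)

/-- The evaluation `P ↦ P(s)`: the variable goes to `s`, and the coefficients go to `S` by `f`. -/
noncomputable def eval {S : Type v} [Ring S] [Algebra ℂ S] (f : R →ₐ[ℂ] S) (s : S) :
    NCPoly R →ₐ[ℂ] S :=
  RingQuot.liftAlgHom ℂ ⟨FreeAlgebra.lift ℂ (fun o => o.elim s f), by
    intro x y h
    cases h <;> simp⟩

theorem eval_mk {S : Type v} [Ring S] [Algebra ℂ S] (f : R →ₐ[ℂ] S) (s : S)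
    (x : FreeAlgebra ℂ (Option R)) :
    eval f s (mk R x) = FreeAlgebra.lift ℂ (fun o => o.elim s f) x :=
  RingQuot.liftAlgHom_mkAlgHom_apply ℂ _ _ x

@[simp]
theorem eval_C {S : Type v} [Ring S] [Algebra ℂ S] (f : R →ₐ[ℂ] S) (s : S) (r : R) :
    eval f s (C r) = f r := by
  change eval f s (mk R _) = _
  simp [eval_mk]

@[simp]
theorem eval_X {S : Type v} [Ring S] [Algebra ℂ S] (f : R →ₐ[ℂ] S) (s : S) :
    eval f s (X : NCPoly R) = s := by
  simp [X, eval_mk]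

/-- A property that holds for constants and for `X`, and passes to sums and products, holds for all
noncommutative polynomials. -/
@[elab_as_elim]
theorem induction {p : NCPoly R → Prop} (hC : ∀ r, p (C r)) (hX : p X)
    (hadd : ∀ P Q, p P → p Q → p (P + Q)) (hmul : ∀ P Q, p P → p Q → p (P * Q))
    (P : NCPoly R) : p P := by
  obtain ⟨x, rfl⟩ := mk_surjective P
  induction x using FreeAlgebra.induction with
  | grade0 c =>
    have h := hC (algebraMap ℂ R c)
    rwa [AlgHom.commutes, ← AlgHom.commutes (mk R)] at h
  | grade1 o =>
    cases o with
    | none => exact hX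
    | some r => exact hC r
  | add a b ha hb => rw [map_add]; exact hadd _ _ ha hb
  | mul a b ha hb => rw [map_mul]; exact hmul _ _ ha hb

end Basic

/-! #### The involution -/

section Star

/-- The opposite algebra with the conjugate scalar multiplication. A homomorphism into it is a
conjugate-linear antihomomorphism. -/
def ConjOp (S : Type u) : Type u := Sᵐᵒᵖ

/-- An element of `S` as an element of the conjugate opposite algebra. -/
def toConj {S : Type u} (s : S) : ConjOp S := MulOpposite.op s

/-- An element of the conjugate opposite algebra as an element of `S`. -/
def ofConj {S : Type u} (s : ConjOp S) : S := MulOpposite.unop (α := S) s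

noncomputable instance (S : Type u) [Ring S] : Ring (ConjOp S) := inferInstanceAs (Ring Sᵐᵒᵖ)

noncomputable instance (S : Type u) [Ring S] [Algebra ℂ S] : Algebra ℂ (ConjOp S) :=
  Algebra.compHom Sᵐᵒᵖ (starRingEnd ℂ)

variable {R : Type u} [Ring R] [StarRing R] [Algebra ℂ R] [StarModule ℂ R]

/-- `r ↦ r*` on coefficients, with values in `R⟨X⟩`. -/
noncomputable def conjC : R →ₐ[ℂ] ConjOp (NCPoly R) :=
  AlgHom.ofLinearMap
    { toFun := fun r => toConj (C (star r))
      map_add' := fun a b => by rw [star_add, map_add]; rfl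
      map_smul' := fun c a => by rw [star_smul, map_smul]; rfl }
    (by change toConj (C (star (1 : R))) = toConj 1
        rw [star_one, map_one])
    (fun a b => by
        change toConj (C (star (a * b))) = toConj (C (star b) * C (star a))
        rw [star_mul, map_mul])

/-- The involution as a homomorphism: it conjugates the coefficients, fixes `X` and reverses
products. -/
noncomputable def starHom : NCPoly R →ₐ[ℂ] ConjOp (NCPoly R) :=
  eval conjC (toConj X)

/-- The involution with `X* = X` which extends the one of `R`:
`(r₀ X r₁ ⋯ X rₙ)* = rₙ* X ⋯ r₁* X r₀*`. -/
noncomputable instance : Star (NCPoly R) :=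
  ⟨fun P => ofConj (starHom P)⟩

theorem star_def (P : NCPoly R) : star P = ofConj (starHom P) := rfl

@[simp]
theorem star_C (r : R) : star (C r : NCPoly R) = C (star r) := by
  rw [star_def, starHom, eval_C]; rfl

@[simp]
theorem star_X : star (X : NCPoly R) = X := by
  rw [star_def, starHom, eval_X]; rfl

theorem star_add' (P Q : NCPoly R) : star (P + Q) = star P + star Q := by
  rw [star_def, map_add]; rfl

theorem star_mul' (P Q : NCPoly R) : star (P * Q) = star Q * star P := by
  rw [star_def, map_mul]; rfl

theorem star_star' (P : NCPoly R) : star (star P) = P := by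
  induction P using NCPoly.induction with
  | hC r => simp
  | hX => simp
  | hadd P Q hP hQ => rw [star_add', star_add', hP, hQ]
  | hmul P Q hP hQ => rw [star_mul', star_mul', hP, hQ]

noncomputable instance : StarRing (NCPoly R) where
  star_involutive := star_star'
  star_mul := star_mul'
  star_add := star_add'

instance : StarModule ℂ (NCPoly R) where
  star_smul c P := by rw [star_def, map_smul]; rfl

end Star

end NCPoly

/-! ### Tracial von Neumann algebras -/

namespace VonNeumannAlgebra

section Trace

variable {H : Type u} [NormedAddCommGroup H] [InnerProductSpace ℂ H] [CompleteSpace H]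

/-- The elements of a von Neumann algebra `B`, as a complex `*`-algebra. -/
abbrev Elem (B : VonNeumannAlgebra H) : Type u := B.toStarSubalgebra

/-- A linear functional on a von Neumann algebra is normal (that is, `σ`-weakly continuous) if its
restriction to the unit ball is continuous for the weak operator topology, which agrees there with
the `σ`-weak topology. -/
def IsNormal (B : VonNeumannAlgebra H) (φ : B.Elem →ₗ[ℂ] ℂ) : Prop :=
  @Continuous {x : B.Elem // ‖(x : H →L[ℂ] H)‖ ≤ 1} ℂ
    (TopologicalSpace.induced
      (fun x => (ContinuousLinearMapWOT.ofCLM ((x : B.Elem) : H →L[ℂ] H) : H →WOT[ℂ] H))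
      inferInstance)
    inferInstance (fun x => φ x)

/-- `τ` is a faithful normal tracial state on `B`, so that `(B, τ)` is a tracial von Neumann
algebra. -/
structure IsFaithfulNormalTrace (B : VonNeumannAlgebra H) (τ : B.Elem →ₗ[ℂ] ℂ) : Prop where
  map_one : τ 1 = 1
  nonneg : ∀ b : B.Elem, 0 ≤ τ (star b * b)
  faithful : ∀ b : B.Elem, τ (star b * b) = 0 → b = 0
  tracial : ∀ b c : B.Elem, τ (b * c) = τ (c * b)
  normal : B.IsNormal τ

end Trace

section ProbabilitySpace

variable {H : Type u} [NormedAddCommGroup H] [InnerProductSpace ℂ H] [CompleteSpace H]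
  (B : VonNeumannAlgebra H) (τ : B.Elem →ₗ[ℂ] ℂ)

/-- A tracial `W*`-probability space `(A, E_B, B)` over the tracial von Neumann algebra `(B, τ)`.
-/
structure TracialProbabilitySpace where
  /-- The Hilbert space on which `A` acts. -/
  K : Type u
  [instNormed : NormedAddCommGroup K]
  [instInner : InnerProductSpace ℂ K]
  [instComplete : CompleteSpace K]
  /-- The tracial von Neumann algebra `A`. -/
  A : VonNeumannAlgebra K
  /-- The trace of `A`. -/
  tr : A.Elem →ₗ[ℂ] ℂ
  isTrace : A.IsFaithfulNormalTrace tr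
  /-- The identification of `B` with a subalgebra of `A`. -/
  incl : B.Elem →⋆ₐ[ℂ] A.Elem
  incl_injective : Function.Injective incl
  /-- The image of `B` is a von Neumann subalgebra. -/
  range_incl : Set.centralizer (Set.centralizer (Set.range fun b => (incl b : K →L[ℂ] K)))
    = Set.range fun b => (incl b : K →L[ℂ] K)
  /-- The trace of `A` restricts to the trace of `B`. -/
  tr_incl : ∀ b, tr (incl b) = τ b
  /-- The trace preserving conditional expectation `E_B`, which the following properties determine.
  -/
  E : A.Elem →ₗ[ℂ] B.Elem
  E_incl : ∀ b, E (incl b) = b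
  E_bimodular : ∀ b a c, E (incl b * a * incl c) = b * E a * c
  E_positive : ∀ a, (E (star a * a) : H →L[ℂ] H).IsPositive
  τ_E : ∀ a, τ (E a) = tr a

attribute [instance] TracialProbabilitySpace.instNormed TracialProbabilitySpace.instInner
  TracialProbabilitySpace.instComplete

end ProbabilitySpace

/-! ### `B`-valued distributions -/

section Distributions

variable {H : Type u} [NormedAddCommGroup H] [InnerProductSpace ℂ H] [CompleteSpace H]
  (B : VonNeumannAlgebra H)

open Matrix in
/-- `B`-valued distributions: unital, `B`-bimodular, completely positive maps `B⟨X⟩ → B`. A matrix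
over `B` is positive in `Mₙ(B)` if it has the form `Y* Y`. -/
structure IsDistribution (μ : NCPoly B.Elem →ₗ[ℂ] B.Elem) : Prop where
  map_one : μ 1 = 1
  bimodular : ∀ (b : B.Elem) (P : NCPoly B.Elem) (c : B.Elem),
    μ (NCPoly.C b * P * NCPoly.C c) = b * μ P * c
  completelyPositive : ∀ (n : ℕ) (P : Fin n → NCPoly B.Elem),
    ∃ Y : Matrix (Fin n) (Fin n) B.Elem,
      Matrix.of (fun i j => μ (star (P i) * P j)) = Yᴴ * Y

/-- `μ` is exponentially bounded by `M`:
`‖μ(X b₁ X ⋯ X bₙ X)‖ ≤ M ^ (n + 1) ‖b₁‖ ⋯ ‖bₙ‖` for all `n ≥ 0` and `b₁, …, bₙ ∈ B`. -/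
def ExpBoundedBy (μ : NCPoly B.Elem →ₗ[ℂ] B.Elem) (M : ℝ) : Prop :=
  ∀ l : List B.Elem,
    ‖(μ (NCPoly.X * (l.map fun b : B.Elem => NCPoly.C b * NCPoly.X).prod) : H →L[ℂ] H)‖
      ≤ M ^ (l.length + 1) * (l.map fun b : B.Elem => ‖(b : H →L[ℂ] H)‖).prod

/-- `Σ₀`: the exponentially bounded `B`-valued distributions. -/
def Sigma0 : Set (NCPoly B.Elem →ₗ[ℂ] B.Elem) :=
  {μ | B.IsDistribution μ ∧ ∃ M : ℝ, B.ExpBoundedBy μ M}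

/-- `Σ₀^τ`: the elements of `Σ₀` which are the distribution `P ↦ E_B(P(a))` of a self-adjoint
element `a` of some tracial `W*`-probability space over `(B, τ)`. -/
def SigmaTau (τ : B.Elem →ₗ[ℂ] ℂ) : Set (NCPoly B.Elem →ₗ[ℂ] B.Elem) :=
  {μ | μ ∈ B.Sigma0 ∧ ∃ (S : TracialProbabilitySpace B τ) (a : S.A.Elem), IsSelfAdjoint a ∧
    ∀ P, μ P = S.E (NCPoly.eval (S.incl : B.Elem →ₐ[ℂ] S.A.Elem) a P)}

end Distributions

end VonNeumannAlgebra

/-! Put φ = τ ∘ μ. Everything turns on condition (3). It holds when μ comes from a tracial space,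
where φ(P) = tr(P(a)). Conversely, complete positivity with (3) makes φ a tracial state on B⟨X⟩, and
then (2) is its Cauchy–Schwarz inequality. The exponential bound gives |φ(X^m)| ≤ M^m. Iterated
Cauchy–Schwarz and the trace property turn this into |φ(P*XP)| ≤ M φ(P*P), which is (1) with the
same M (`norm_apply_star_mul_mul_le`).

To realize μ from a tracial φ, represent B⟨X⟩ on the GNS space of φ. Left multiplications by
constants are bounded because ‖b‖² - b*b is a square in B, and that by X because of its moments
(`ExpBoundedBy.isBounded`). Let A be the generated von Neumann algebra and ξ the class of 1. Right
multiplications are bounded too and commute with A, so ξ is separating; with the conjugation p ↦ p*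
they show that the vector state of ξ is a trace on all of A.

It remains to find E_B and to see that B is a von Neumann subalgebra of A. For self-adjoint a in A
the functional b ↦ tr(ab) on B is dominated by a multiple of τ, hence equals τ(c ·) for some c in B
(`exists_eq_trace_mul`), and E_B(a) = c. This derivative comes from weak compactness of the unit
ball of B and Hahn–Banach separation, so normality of b ↦ tr(ab) need not be known beforehand.
Finally E_B(P(a)) = μ(P) for a the image of X, since both have the same trace against every b in B.
-/

/-! ### The GNS representation of a tracial state on a complex `*`-algebra -/

section GNS

variable {P : Type u} [Ring P] [StarRing P] [Algebra ℂ P] [StarModule ℂ P]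

/-- Tracial states on a complex unital `*`-algebra. -/
structure IsTracialState (φ : P →ₗ[ℂ] ℂ) : Prop where
  map_one : φ 1 = 1
  nonneg : ∀ p, 0 ≤ φ (star p * p)
  tracial : ∀ p q, φ (p * q) = φ (q * p)

namespace IsTracialState

variable {φ : P →ₗ[ℂ] ℂ}

theorem map_star (hφ : IsTracialState φ) (p : P) : φ (star p) = star (φ p) := by
  -- Polarization: the values of φ on the squares of 1 + p and 1 + ip are real, which gives the
  -- imaginary and the real part of the claim.
  have h1 := (Complex.nonneg_iff.mp (hφ.nonneg (1 + p))).2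
  have h2 := (Complex.nonneg_iff.mp (hφ.nonneg (1 + Complex.I • p))).2
  have h3 := (Complex.nonneg_iff.mp (hφ.nonneg p)).2
  simp only [star_add, star_one, star_smul, add_mul, mul_add, one_mul, mul_one, map_add,
    smul_mul_assoc, mul_smul_comm, map_smul, hφ.map_one, Complex.add_im,
    Complex.one_im, smul_eq_mul] at h1 h2
  simp [← h3] at h1 h2
  apply Complex.ext <;> simp <;> linarith

/-- A type synonym of `P` which carries the inner product given by a tracial state. -/
def PreGNS (_ : IsTracialState φ) : Type u := P

variable (hφ : IsTracialState φ)

noncomputable instance : AddCommGroup hφ.PreGNS := inferInstanceAs (AddCommGroup P)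
noncomputable instance : Module ℂ hφ.PreGNS := inferInstanceAs (Module ℂ P)

/-- The identification of the algebra with its pre-Hilbert space. -/
noncomputable def toPreGNS : P ≃ₗ[ℂ] hφ.PreGNS := LinearEquiv.refl ℂ _

/-- The semi-inner product `⟨p, q⟩ = φ(p* q)`. -/
noncomputable abbrev preGNSCore : PreInnerProductSpace.Core ℂ hφ.PreGNS where
  inner a b := φ (star (hφ.toPreGNS.symm a) * hφ.toPreGNS.symm b)
  conj_inner_symm a b := by
    rw [starRingEnd_apply, ← hφ.map_star, star_mul, star_star]
  re_inner_nonneg a := (Complex.nonneg_iff.mp (hφ.nonneg _)).1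
  add_left a b c := by rw [map_add, star_add, add_mul, map_add]
  smul_left a b c := by simp

noncomputable instance : SeminormedAddCommGroup hφ.PreGNS :=
  InnerProductSpace.Core.toSeminormedAddCommGroup (c := hφ.preGNSCore)

noncomputable instance : InnerProductSpace ℂ hφ.PreGNS :=
  InnerProductSpace.ofCore hφ.preGNSCore

theorem inner_toPreGNS (p q : P) :
    inner ℂ (hφ.toPreGNS p) (hφ.toPreGNS q) = φ (star p * q) := rfl

theorem norm_sq_toPreGNS (p : P) : ((‖hφ.toPreGNS p‖ ^ 2 : ℝ) : ℂ) = φ (star p * p) := by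
  rw [← hφ.inner_toPreGNS, inner_self_eq_norm_sq_to_K]
  simp

theorem ofReal_re_apply_star_mul_self (hφ : IsTracialState φ) (p : P) :
    ((φ (star p * p)).re : ℂ) = φ (star p * p) := by
  rw [← hφ.norm_sq_toPreGNS, Complex.ofReal_re]

theorem norm_apply_star_mul_sq_le (hφ : IsTracialState φ) (p q : P) :
    ‖φ (star p * q)‖ ^ 2 ≤ (φ (star p * p)).re * (φ (star q * q)).re := by
  rw [← hφ.norm_sq_toPreGNS, ← hφ.norm_sq_toPreGNS, Complex.ofReal_re, Complex.ofReal_re,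
    ← hφ.inner_toPreGNS, ← mul_pow]
  gcongr
  exact norm_inner_le_norm _ _

/-- All left multiplications are bounded for the norm of the GNS space. -/
def IsBounded (φ : P →ₗ[ℂ] ℂ) : Prop :=
  ∀ p, ∃ c : ℝ, ∀ q, (φ (star (p * q) * (p * q))).re ≤ c * (φ (star q * q)).re

variable {hφ}

theorem norm_toPreGNS_mul_le (hb : IsBounded φ) (p : P) :
    ∃ c : ℝ, ∀ q, ‖hφ.toPreGNS (p * q)‖ ≤ c * ‖hφ.toPreGNS q‖ := by
  obtain ⟨c, hc⟩ := hb p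
  refine ⟨√(max c 0), fun q => ?_⟩
  rw [← sq_le_sq₀ (by positivity) (by positivity), mul_pow, Real.sq_sqrt (by positivity)]
  have h := hc q
  rw [← hφ.norm_sq_toPreGNS, ← hφ.norm_sq_toPreGNS, Complex.ofReal_re, Complex.ofReal_re] at h
  exact h.trans (by gcongr; exact le_max_left _ _)

/-- This is where traciality enters: p ↦ p* is isometric, so bounds for left multiplication carry
over to right multiplication through qp = (p*q*)*. -/
theorem norm_toPreGNS_star (p : P) : ‖hφ.toPreGNS (star p)‖ = ‖hφ.toPreGNS p‖ := by
  rw [← sq_eq_sq₀ (by positivity) (by positivity), ← Complex.ofReal_inj, hφ.norm_sq_toPreGNS,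
    hφ.norm_sq_toPreGNS, star_star, hφ.tracial]

theorem norm_toPreGNS_mul_le' (hb : IsBounded φ) (p : P) :
    ∃ c : ℝ, ∀ q, ‖hφ.toPreGNS (q * p)‖ ≤ c * ‖hφ.toPreGNS q‖ := by
  obtain ⟨c, hc⟩ := norm_toPreGNS_mul_le (hφ := hφ) hb (star p)
  refine ⟨c, fun q => ?_⟩
  rw [← norm_toPreGNS_star, star_mul, ← norm_toPreGNS_star (p := q)]
  exact hc _

variable (hφ) in
/-- The GNS space. -/
abbrev GNS : Type u := UniformSpace.Completion hφ.PreGNS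

variable (hφ) in
/-- The class of an element of the algebra in the GNS space. -/
noncomputable def vec (p : P) : hφ.GNS := (hφ.toPreGNS p : hφ.GNS)

theorem inner_vec (p q : P) : inner ℂ (hφ.vec p) (hφ.vec q) = φ (star p * q) := by
  rw [vec, vec, UniformSpace.Completion.inner_coe, inner_toPreGNS]

theorem denseRange_vec : DenseRange hφ.vec :=
  (UniformSpace.Completion.denseRange_coe).comp hφ.toPreGNS.surjective.denseRange
    (UniformSpace.Completion.continuous_coe _)

/-- The completion of the seminormed space is separated, so null vectors need no separate quotient:
the bound already makes f respect them. -/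
theorem exists_clm {f : P →ₗ[ℂ] P}
    (hf : ∃ c : ℝ, ∀ q, ‖hφ.toPreGNS (f q)‖ ≤ c * ‖hφ.toPreGNS q‖) :
    ∃ T : hφ.GNS →L[ℂ] hφ.GNS, ∀ q, T (hφ.vec q) = hφ.vec (f q) := by
  obtain ⟨c, hc⟩ := hf
  refine ⟨((hφ.toPreGNS.toLinearMap ∘ₗ f ∘ₗ hφ.toPreGNS.symm.toLinearMap).mkContinuous c
    fun x => hc (hφ.toPreGNS.symm x)).completion, fun q => ?_⟩
  rw [vec, ContinuousLinearMap.completion_apply_coe]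
  rfl

theorem clm_ext {S T : hφ.GNS →L[ℂ] hφ.GNS} (h : ∀ q, S (hφ.vec q) = T (hφ.vec q)) : S = T :=
  DFunLike.coe_injective (denseRange_vec.equalizer S.continuous T.continuous (funext h))

theorem clm_eq_star {S T : hφ.GNS →L[ℂ] hφ.GNS}
    (h : ∀ p q, inner ℂ (S (hφ.vec p)) (hφ.vec q) = inner ℂ (hφ.vec p) (T (hφ.vec q))) :
    S = star T := by
  refine clm_ext fun p => ?_
  refine denseRange_vec.eq_of_inner_right ℂ ?_
  intro q
  rw [ContinuousLinearMap.star_eq_adjoint, ContinuousLinearMap.adjoint_inner_right,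
    ← inner_conj_symm, h, inner_conj_symm]

/-! ### Left and right multiplications, and the trace on the generated algebra -/

section Representation

variable (hφ) (hb : IsBounded φ)

/-- The operator of left multiplication by `p`. -/
noncomputable def leftMul (p : P) : hφ.GNS →L[ℂ] hφ.GNS :=
  (exists_clm (f := LinearMap.mulLeft ℂ p) (norm_toPreGNS_mul_le hb p)).choose

/-- The operator of right multiplication by `p`. -/
noncomputable def rightMul (p : P) : hφ.GNS →L[ℂ] hφ.GNS :=
  (exists_clm (f := LinearMap.mulRight ℂ p) (norm_toPreGNS_mul_le' hb p)).choose

@[simp]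
theorem leftMul_vec (p q : P) : hφ.leftMul hb p (hφ.vec q) = hφ.vec (p * q) :=
  (exists_clm (f := LinearMap.mulLeft ℂ p) (norm_toPreGNS_mul_le hb p)).choose_spec q

@[simp]
theorem rightMul_vec (p q : P) : hφ.rightMul hb p (hφ.vec q) = hφ.vec (q * p) :=
  (exists_clm (f := LinearMap.mulRight ℂ p) (norm_toPreGNS_mul_le' hb p)).choose_spec q

theorem vec_add (p q : P) : hφ.vec (p + q) = hφ.vec p + hφ.vec q := by
  rw [vec, map_add, UniformSpace.Completion.coe_add]; rfl

theorem vec_smul (c : ℂ) (p : P) : hφ.vec (c • p) = c • hφ.vec p := by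
  rw [vec, map_smul, UniformSpace.Completion.coe_smul]; rfl

/-- The GNS representation by left multiplications. -/
noncomputable def gnsRep : P →⋆ₐ[ℂ] (hφ.GNS →L[ℂ] hφ.GNS) where
  toFun := hφ.leftMul hb
  map_one' := clm_ext fun q => by simp
  map_mul' p q := clm_ext fun r => by simp [mul_assoc]
  map_zero' := clm_ext fun q => by
    rw [leftMul_vec, zero_mul, ← zero_smul ℂ (0 : P), vec_smul, zero_smul]; rfl
  map_add' p q := clm_ext fun r => by simp [add_mul, vec_add]
  commutes' c := clm_ext fun q => by
    simp [Algebra.algebraMap_eq_smul_one, vec_smul]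
  map_star' p := clm_eq_star fun q r => by simp [inner_vec, mul_assoc]

@[simp]
theorem gnsRep_vec (p q : P) : hφ.gnsRep hb p (hφ.vec q) = hφ.vec (p * q) :=
  hφ.leftMul_vec hb p q

theorem star_rightMul (p : P) : star (hφ.rightMul hb p) = hφ.rightMul hb (star p) := by
  refine (clm_eq_star fun q r => ?_).symm
  rw [rightMul_vec, rightMul_vec, inner_vec, inner_vec, star_mul, star_star, mul_assoc,
    hφ.tracial, mul_assoc]

theorem rightMul_mem_centralizer (p : P) :
    hφ.rightMul hb p ∈ Set.centralizer (Set.range (hφ.gnsRep hb)) := by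
  rintro _ ⟨q, rfl⟩
  exact clm_ext fun r => by simp [mul_assoc]

/-- The conjugation `J` with `J p = p*` of the GNS space. -/
noncomputable def conj : hφ.GNS → hφ.GNS :=
  UniformSpace.Completion.map fun x : hφ.PreGNS => hφ.toPreGNS (star (hφ.toPreGNS.symm x))

theorem conj_vec (p : P) : hφ.conj (hφ.vec p) = hφ.vec (star p) := by
  have h : UniformContinuous
      fun x : hφ.PreGNS => hφ.toPreGNS (star (hφ.toPreGNS.symm x)) :=
    (AddMonoidHomClass.isometry_of_norm ((hφ.toPreGNS.toAddEquiv.toAddMonoidHom.comp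
      (starAddEquiv (R := P)).toAddMonoidHom).comp hφ.toPreGNS.symm.toAddEquiv.toAddMonoidHom)
      fun x => norm_toPreGNS_star (hφ := hφ) _).uniformContinuous
  rw [conj, vec, UniformSpace.Completion.map_coe h]
  rfl

theorem continuous_conj : Continuous hφ.conj := UniformSpace.Completion.continuous_map

theorem inner_conj_comm (x y : hφ.GNS) : inner ℂ (hφ.conj x) y = inner ℂ (hφ.conj y) x := by
  have hc := hφ.continuous_conj
  refine denseRange_vec.induction_on₂ (isClosed_eq ?_ ?_) (fun p q => ?_) x y
  · fun_prop
  · fun_prop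
  · rw [hφ.conj_vec, hφ.conj_vec, inner_vec, inner_vec, star_star, star_star, hφ.tracial]

/-- The von Neumann algebra generated by the GNS representation. -/
noncomputable def gnsAlgebra : VonNeumannAlgebra hφ.GNS where
  toStarSubalgebra := StarSubalgebra.centralizer ℂ
    (StarSubalgebra.centralizer ℂ (Set.range (hφ.gnsRep hb)) : Set (hφ.GNS →L[ℂ] hφ.GNS))
  centralizer_centralizer' := Set.centralizer_centralizer_centralizer _

theorem star_range_gnsRep : star (Set.range (hφ.gnsRep hb)) = Set.range (hφ.gnsRep hb) := by
  ext x
  constructor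
  · rintro ⟨p, hp⟩
    exact ⟨star p, by rw [StarHomClass.map_star, hp, star_star]⟩
  · rintro ⟨p, rfl⟩
    exact ⟨star p, by rw [StarHomClass.map_star]⟩

/-- `StarSubalgebra.centralizer` uses the set together with its adjoints; both sets here are closed
under adjoints, so the unions collapse. -/
theorem coe_gnsAlgebra : (hφ.gnsAlgebra hb : Set (hφ.GNS →L[ℂ] hφ.GNS)) =
    Set.centralizer (Set.centralizer (Set.range (hφ.gnsRep hb))) := by
  change Set.centralizer (_ ∪ star _) = _
  rw [StarMemClass.star_coe_eq, Set.union_self, StarSubalgebra.coe_centralizer,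
    star_range_gnsRep, Set.union_self]

theorem gnsRep_mem (p : P) : hφ.gnsRep hb p ∈ (hφ.gnsAlgebra hb).toStarSubalgebra := by
  rw [VonNeumannAlgebra.mem_carrier, hφ.coe_gnsAlgebra]
  exact Set.subset_centralizer_centralizer ⟨p, rfl⟩

/-- The GNS representation, with values in the von Neumann algebra which it generates. -/
noncomputable def gnsHom : P →⋆ₐ[ℂ] (hφ.gnsAlgebra hb).Elem :=
  (hφ.gnsRep hb).codRestrict _ (hφ.gnsRep_mem hb)

variable {hb}

theorem apply_rightMul {T : hφ.GNS →L[ℂ] hφ.GNS} (hT : T ∈ (hφ.gnsAlgebra hb).toStarSubalgebra)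
    (p : P) (x : hφ.GNS) : T (hφ.rightMul hb p x) = hφ.rightMul hb p (T x) := by
  rw [VonNeumannAlgebra.mem_carrier, hφ.coe_gnsAlgebra] at hT
  exact congr($(hT _ (rightMul_mem_centralizer hφ hb p)) x).symm

/-- Test against the class of p, which is the right multiplication R_p applied to the class of 1. T
commutes with R_p, and the adjoint of R_p is R_{p*}. -/
theorem conj_apply_vec_one {T : hφ.GNS →L[ℂ] hφ.GNS}
    (hT : T ∈ (hφ.gnsAlgebra hb).toStarSubalgebra) :
    hφ.conj (T (hφ.vec 1)) = star T (hφ.vec 1) := by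
  refine (denseRange_vec.eq_of_inner_left ℂ fun p => ?_)
  have h : hφ.vec p = hφ.rightMul hb p (hφ.vec 1) := by rw [rightMul_vec, one_mul]
  have h' : inner ℂ (hφ.vec 1) (T (hφ.vec p)) = inner ℂ (hφ.vec (star p)) (T (hφ.vec 1)) := by
    rw [h, hφ.apply_rightMul hT, ← ContinuousLinearMap.adjoint_inner_left,
      ← ContinuousLinearMap.star_eq_adjoint, star_rightMul, rightMul_vec, one_mul]
  rw [hφ.inner_conj_comm, hφ.conj_vec, ContinuousLinearMap.star_eq_adjoint,
    ContinuousLinearMap.adjoint_inner_left, h']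

/-- With ξ the class of 1: ⟨ξ, STξ⟩ = ⟨JSξ, Tξ⟩ = ⟨JTξ, Sξ⟩ = ⟨ξ, TSξ⟩, since JSξ = S*ξ and JTξ =
T*ξ. -/
theorem inner_mul_comm {S T : hφ.GNS →L[ℂ] hφ.GNS}
    (hS : S ∈ (hφ.gnsAlgebra hb).toStarSubalgebra)
    (hT : T ∈ (hφ.gnsAlgebra hb).toStarSubalgebra) :
    inner ℂ (hφ.vec 1) (S (T (hφ.vec 1))) = inner ℂ (hφ.vec 1) (T (S (hφ.vec 1))) := by
  rw [← ContinuousLinearMap.adjoint_inner_left, ← ContinuousLinearMap.star_eq_adjoint,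
    ← hφ.conj_apply_vec_one hS, hφ.inner_conj_comm, hφ.conj_apply_vec_one hT,
    ContinuousLinearMap.star_eq_adjoint, ContinuousLinearMap.adjoint_inner_left]

/-- The class of 1 is cyclic for the right multiplications, which commute with T; hence it is
separating. -/
theorem eq_zero_of_apply_vec_one {T : hφ.GNS →L[ℂ] hφ.GNS}
    (hT : T ∈ (hφ.gnsAlgebra hb).toStarSubalgebra) (h : T (hφ.vec 1) = 0) : T = 0 := by
  refine clm_ext fun p => ?_
  rw [← one_mul p, ← rightMul_vec hφ hb, hφ.apply_rightMul hT, h, map_zero]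
  rfl

variable (hb) in
/-- The vector state of the class of `1`. -/
noncomputable def gnsTrace : (hφ.gnsAlgebra hb).Elem →ₗ[ℂ] ℂ where
  toFun T := inner ℂ (hφ.vec 1) ((T : hφ.GNS →L[ℂ] hφ.GNS) (hφ.vec 1))
  map_add' S T := by simp [inner_add_right]
  map_smul' c T := by simp [inner_smul_right]

variable (hb) in
theorem isFaithfulNormalTrace_gnsTrace :
    (hφ.gnsAlgebra hb).IsFaithfulNormalTrace (hφ.gnsTrace hb) where
  map_one := by
    change inner ℂ (hφ.vec 1) (hφ.vec 1) = 1
    rw [inner_vec, star_one, one_mul, hφ.map_one]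
  nonneg T := by
    change 0 ≤ inner ℂ (hφ.vec 1) ((star T.1 * T.1) (hφ.vec 1))
    rw [mul_apply_eq_comp, ContinuousLinearMap.star_eq_adjoint,
      ContinuousLinearMap.adjoint_inner_right]
    rw [inner_self_eq_norm_sq_to_K]
    positivity
  faithful T h := by
    change inner ℂ (hφ.vec 1) ((star T.1 * T.1) (hφ.vec 1)) = 0 at h
    rw [mul_apply_eq_comp, ContinuousLinearMap.star_eq_adjoint,
      ContinuousLinearMap.adjoint_inner_right, inner_self_eq_zero] at h
    exact Subtype.ext (hφ.eq_zero_of_apply_vec_one T.2 h)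
  tracial S T := hφ.inner_mul_comm S.2 T.2
  normal := by
    have h : Continuous fun x : hφ.GNS →WOT[ℂ] hφ.GNS => inner ℂ (hφ.vec 1) (x (hφ.vec 1)) :=
      ContinuousLinearMapWOT.continuous_inner_apply continuous_id _ _
    let f : {x : (hφ.gnsAlgebra hb).Elem // ‖(x : hφ.GNS →L[ℂ] hφ.GNS)‖ ≤ 1} →
        hφ.GNS →WOT[ℂ] hφ.GNS :=
      fun x => ContinuousLinearMapWOT.ofCLM ((x : (hφ.gnsAlgebra hb).Elem) : hφ.GNS →L[ℂ] hφ.GNS)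
    exact @Continuous.comp _ _ _ (.induced f inferInstance) _ _ f _ h continuous_induced_dom

theorem gnsTrace_gnsHom (p : P) : hφ.gnsTrace hb (hφ.gnsHom hb p) = φ p := by
  change inner ℂ (hφ.vec 1) (hφ.gnsRep hb p (hφ.vec 1)) = _
  rw [gnsRep_vec, inner_vec, star_one, one_mul, mul_one]

end Representation

end IsTracialState

end GNS

/-! ### A Radon–Nikodym theorem for normal traces -/

namespace VonNeumannAlgebra

open Filter Topology

variable {H : Type u} [NormedAddCommGroup H] [InnerProductSpace ℂ H] [CompleteSpace H]
  {B : VonNeumannAlgebra H}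

/-! ### Continuous functional calculus inside B -/

section FunctionalCalculus

theorem mem_of_forall_commute {x : H →L[ℂ] H}
    (h : ∀ y ∈ Set.centralizer (B : Set (H →L[ℂ] H)), Commute x y) : x ∈ B.toStarSubalgebra := by
  rw [mem_carrier, ← centralizer_centralizer]
  exact fun y hy => (h y hy).eq.symm

theorem cfc_mem {x : H →L[ℂ] H} (hx : x ∈ B.toStarSubalgebra) (f : ℝ → ℝ) :
    cfc f x ∈ B.toStarSubalgebra :=
  mem_of_forall_commute fun _ hy => Commute.cfc_real (hy x hx) f

/-- The real continuous functional calculus of a von Neumann algebra. -/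
noncomputable def cfcElem (f : ℝ → ℝ) (b : B.Elem) : B.Elem :=
  ⟨cfc f (b : H →L[ℂ] H), cfc_mem b.2 f⟩

theorem isSelfAdjoint_coe {b : B.Elem} (hb : IsSelfAdjoint b) :
    IsSelfAdjoint (b : H →L[ℂ] H) := congrArg Subtype.val hb

theorem isSelfAdjoint_cfcElem (f : ℝ → ℝ) (b : B.Elem) : IsSelfAdjoint (cfcElem f b) :=
  Subtype.ext (cfc_predicate f (b : H →L[ℂ] H))

theorem cfcElem_mul {f g : ℝ → ℝ} (hf : Continuous f) (hg : Continuous g) (b : B.Elem) :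
    cfcElem (fun t => f t * g t) b = cfcElem f b * cfcElem g b :=
  Subtype.ext (cfc_mul f g (b : H →L[ℂ] H) hf.continuousOn hg.continuousOn)

theorem cfcElem_add {f g : ℝ → ℝ} (hf : Continuous f) (hg : Continuous g) (b : B.Elem) :
    cfcElem (fun t => f t + g t) b = cfcElem f b + cfcElem g b :=
  Subtype.ext (cfc_add (b : H →L[ℂ] H) f g hf.continuousOn hg.continuousOn)

theorem cfcElem_sub {f g : ℝ → ℝ} (hf : Continuous f) (hg : Continuous g) (b : B.Elem) :
    cfcElem (fun t => f t - g t) b = cfcElem f b - cfcElem g b :=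
  Subtype.ext (cfc_sub f g (b : H →L[ℂ] H) hf.continuousOn hg.continuousOn)

theorem cfcElem_id {b : B.Elem} (hb : IsSelfAdjoint b) : cfcElem (fun t => t) b = b :=
  Subtype.ext (cfc_id' ℝ (b : H →L[ℂ] H) (isSelfAdjoint_coe hb))

theorem cfcElem_const {b : B.Elem} (hb : IsSelfAdjoint b) (r : ℝ) :
    cfcElem (fun _ => r) b = (r : ℂ) • 1 :=
  Subtype.ext <| (cfc_const r (b : H →L[ℂ] H) (isSelfAdjoint_coe hb)).trans <| by
    rw [Algebra.algebraMap_eq_smul_one]; rfl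

/-- A self-adjoint `b` is a difference `u² - v²` of positive elements whose sum is up to `ε` a
product `c b` with `c` in the unit ball. -/
theorem exists_approx_abs {b : B.Elem} (hb : IsSelfAdjoint b) {ε : ℝ} (hε : 0 < ε) :
    ∃ c u v : B.Elem, ‖(c : H →L[ℂ] H)‖ ≤ 1 ∧ IsSelfAdjoint u ∧ IsSelfAdjoint v ∧
      b = u * u - v * v ∧ c * b + (ε : ℂ) • 1 = u * u + v * v := by
  have hpos : ∀ t : ℝ, 0 < |t| + ε := fun t => by positivity
  have hne : ∀ t : ℝ, |t| + ε ≠ 0 := fun t => (hpos t).ne'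
  -- A continuous substitute for the sign function. Since f(t)t + ε ≥ |t|, the functions (f(t)t + ε
  -- ± t)/2 are nonnegative and have continuous square roots p and q.
  let f : ℝ → ℝ := fun t => t / (|t| + ε)
  have hf : Continuous f := by fun_prop (disch := exact hne _)
  let p : ℝ → ℝ := fun t => √((f t * t + ε + t) / 2)
  let q : ℝ → ℝ := fun t => √((f t * t + ε - t) / 2)
  have hp : Continuous p := by fun_prop
  have hq : Continuous q := by fun_prop
  have hg : ∀ t : ℝ, |t| ≤ f t * t + ε := fun t => by
    have : f t * t + ε - |t| = ε ^ 2 / (|t| + ε) := by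
      simp only [f]
      field_simp [hne t]
      nlinarith [sq_abs t]
    have h2 : 0 ≤ ε ^ 2 / (|t| + ε) := by positivity
    linarith
  have hpp : ∀ t, p t * p t = (f t * t + ε + t) / 2 := fun t =>
    Real.mul_self_sqrt (by linarith [hg t, neg_abs_le t])
  have hqq : ∀ t, q t * q t = (f t * t + ε - t) / 2 := fun t =>
    Real.mul_self_sqrt (by linarith [hg t, le_abs_self t])
  refine ⟨cfcElem f b, cfcElem p b, cfcElem q b, ?_, isSelfAdjoint_cfcElem _ _,
    isSelfAdjoint_cfcElem _ _, ?_, ?_⟩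
  · refine norm_cfc_le zero_le_one fun t _ => ?_
    rw [Real.norm_eq_abs, abs_div, abs_of_pos (hpos t), div_le_one (hpos t)]
    linarith
  · rw [← cfcElem_mul hp hp, ← cfcElem_mul hq hq,
      ← cfcElem_sub (f := fun t => p t * p t) (g := fun t => q t * q t) (by fun_prop) (by fun_prop)]
    simp only [hpp, hqq]
    conv_lhs => rw [← cfcElem_id hb]
    congr 1
    ext t
    ring
  · rw [← cfcElem_mul hp hp, ← cfcElem_mul hq hq,
      ← cfcElem_add (f := fun t => p t * p t) (g := fun t => q t * q t) (by fun_prop) (by fun_prop)]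
    simp only [hpp, hqq]
    conv_lhs => rw [← cfcElem_const hb]; arg 1; arg 2; rw [← cfcElem_id hb]
    rw [← cfcElem_mul hf continuous_id', ← cfcElem_add (f := fun t => f t * t) (g := fun _ => ε)
      (by fun_prop) (by fun_prop)]
    congr 1
    ext t
    ring

end FunctionalCalculus

/-! ### Weak compactness of the unit ball -/

section UnitBall

variable (B) in
/-- The unit ball of a von Neumann algebra. -/
def UnitBall : Type u := {x : B.Elem // ‖(x : H →L[ℂ] H)‖ ≤ 1}

/-- The weak operator topology of the unit ball. -/
noncomputable instance : TopologicalSpace B.UnitBall :=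
  TopologicalSpace.induced (fun x => (ContinuousLinearMapWOT.ofCLM ((x.1 : B.Elem) : H →L[ℂ] H) :
    H →WOT[ℂ] H)) inferInstance

theorem tendsto_unitBall_iff {α : Type*} {l : Filter α} {f : α → B.UnitBall} {c : B.UnitBall} :
    Tendsto f l (𝓝 c) ↔ ∀ v w : H, Tendsto (fun a => inner ℂ w (((f a).1 : H →L[ℂ] H) v)) l
      (𝓝 (inner ℂ w ((c.1 : H →L[ℂ] H) v))) := by
  rw [nhds_induced, tendsto_comap_iff,
    ContinuousLinearMapWOT.tendsto_iff_forall_inner_apply_tendsto]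
  rfl

theorem exists_tendsto_inner (U : Ultrafilter B.UnitBall) (v w : H) :
    ∃ z : ℂ, ‖z‖ ≤ ‖v‖ * ‖w‖ ∧
      Tendsto (fun c : B.UnitBall => inner ℂ ((c.1 : H →L[ℂ] H) v) w) U (𝓝 z) := by
  have h : ∀ c : B.UnitBall,
      inner ℂ ((c.1 : H →L[ℂ] H) v) w ∈ Metric.closedBall (0 : ℂ) (‖v‖ * ‖w‖) := fun c => by
    rw [mem_closedBall_zero_iff]
    refine (norm_inner_le_norm _ _).trans ?_
    gcongr
    exact ContinuousLinearMap.le_of_opNorm_le _ c.2 v |>.trans_eq (one_mul _)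
  obtain ⟨z, hz, hz'⟩ := (isCompact_closedBall (0 : ℂ) (‖v‖ * ‖w‖)).ultrafilter_le_nhds
    (U.map fun c => inner ℂ ((c.1 : H →L[ℂ] H) v) w) (by
      
      rw [le_principal_iff]; exact Filter.univ_mem' (s := _ ⁻¹' _) h)
  exact ⟨z, mem_closedBall_zero_iff.mp hz, hz'⟩

/-- Along an ultrafilter the forms ⟨cv, w⟩ converge to a sesquilinear form bounded by 1, hence to
the form of an operator T in the unit ball. Commutation with the commutant of B passes to the limit,
so T lies in B. -/
instance : CompactSpace B.UnitBall := by
  refine ⟨isCompact_iff_ultrafilter_le_nhds.mpr fun U _ => ?_⟩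
  choose L hL hlim using exists_tendsto_inner U
  let F : H →L⋆[ℂ] H →L[ℂ] ℂ := LinearMap.mkContinuous₂
    (LinearMap.mk₂'ₛₗ (starRingEnd ℂ) (RingHom.id ℂ) L
      (fun v v' w => tendsto_nhds_unique (hlim _ _) (by
        simpa [inner_add_left] using (hlim v w).add (hlim v' w)))
      (fun r v w => tendsto_nhds_unique (hlim _ _) (by
        simpa [inner_smul_left, mul_comm] using (hlim v w).const_mul (starRingEnd ℂ r)))
      (fun v w w' => tendsto_nhds_unique (hlim _ _) (by
        simpa [inner_add_right] using (hlim v w).add (hlim v w')))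
      (fun r v w => tendsto_nhds_unique (hlim _ _) (by
        simpa [inner_smul_right] using (hlim v w).const_mul r))) 1
    fun v w => by simpa using hL v w
  let T : H →L[ℂ] H := InnerProductSpace.continuousLinearMapOfBilin F
  have hT : ∀ v w, inner ℂ (T v) w = L v w := fun v w =>
    InnerProductSpace.continuousLinearMapOfBilin_apply F v w
  have hmem : T ∈ B.toStarSubalgebra := by
    refine mem_of_forall_commute fun y hy => ContinuousLinearMap.ext fun v => ?_
    refine ext_inner_right ℂ fun w => ?_
    change inner ℂ (T (y v)) w = inner ℂ (y (T v)) w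
    rw [← ContinuousLinearMap.adjoint_inner_right y, hT, hT]
    refine tendsto_nhds_unique (hlim _ _) ((hlim _ _).congr fun c => ?_)
    rw [ContinuousLinearMap.adjoint_inner_right]
    exact congr(inner ℂ ($(hy c.1.1 c.1.2) v) w).symm
  have hnorm : ‖T‖ ≤ 1 := by
    refine T.opNorm_le_bound zero_le_one fun v => ?_
    by_cases h0 : T v = 0
    · rw [h0, norm_zero]; positivity
    · have h := hL v (T v)
      rw [← hT, inner_self_eq_norm_sq_to_K, norm_pow, RCLike.norm_ofReal, abs_norm, sq] at h
      rw [one_mul]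
      exact le_of_mul_le_mul_right h (norm_pos_iff.mpr h0)
  refine ⟨⟨⟨T, hmem⟩, hnorm⟩, trivial, ?_⟩
  refine (tendsto_unitBall_iff (f := id)).mpr fun v w => ?_
  have h := (hlim v w).star
  rw [← hT] at h
  simpa using h

theorem IsFaithfulNormalTrace.continuous_mul_right {τ : B.Elem →ₗ[ℂ] ℂ}
    (hτ : B.IsFaithfulNormalTrace τ) (b : B.Elem) :
    Continuous fun c : B.UnitBall => τ (c.1 * b) := by
  -- Normality concerns the unit ball only, so b is scaled until c ↦ cb maps the ball to itself; the
  -- summand 1 keeps r positive when b = 0.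
  let r : ℝ := ‖(b : H →L[ℂ] H)‖ + 1
  have hr : 0 < r := by positivity
  let b' : B.Elem := ((r⁻¹ : ℝ) : ℂ) • b
  have hb' : ‖(b' : H →L[ℂ] H)‖ ≤ 1 := by
    change ‖((r⁻¹ : ℝ) : ℂ) • (b : H →L[ℂ] H)‖ ≤ 1
    rw [norm_smul, Complex.norm_real, Real.norm_of_nonneg (by positivity), inv_mul_le_one₀ hr]
    simp [r]
  have hbb : b = (r : ℂ) • b' := by
    simp only [b', smul_smul]
    rw [← Complex.ofReal_mul, mul_inv_cancel₀ hr.ne', Complex.ofReal_one, one_smul]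
  let m : B.UnitBall → B.UnitBall := fun c => ⟨c.1 * b',
    (norm_mul_le _ _).trans (mul_le_one₀ c.2 (norm_nonneg _) hb')⟩
  have hm : Continuous m := by
    refine continuous_iff_continuousAt.mpr fun c => tendsto_unitBall_iff.mpr fun v w => ?_
    exact tendsto_unitBall_iff.mp tendsto_id ((b' : H →L[ℂ] H) v) w
  have hn : Continuous fun c : B.UnitBall => τ c.1 := hτ.normal
  have : (fun c : B.UnitBall => τ (c.1 * b)) = fun c => (r : ℂ) * τ (m c).1 := by
    ext c
    rw [hbb, mul_smul_comm, map_smul]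
    rfl
  rw [this]
  exact continuous_const.mul (hn.comp hm)

end UnitBall

end VonNeumannAlgebra

namespace VonNeumannAlgebra

open Filter Topology

variable {H : Type u} [NormedAddCommGroup H] [InnerProductSpace ℂ H] [CompleteSpace H]
  {B : VonNeumannAlgebra H} {τ : B.Elem →ₗ[ℂ] ℂ}

theorem IsFaithfulNormalTrace.isTracialState (hτ : B.IsFaithfulNormalTrace τ) :
    IsTracialState τ := ⟨hτ.map_one, hτ.nonneg, hτ.tracial⟩

/-! ### Functionals dominated by the trace -/

section RadonNikodym

variable {ψ : B.Elem →ₗ[ℂ] ℂ}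

/-- Write b = u² - v² with u² + v² = cb + ε. Then Re ψ(b) ≤ Re τ(u² + v²) = Re τ(cb) + ε. So ψ lies
below the support function of the functionals τ(c ·), as the separation argument needs. -/
theorem re_le_of_forall_unitBall (hτ : B.IsFaithfulNormalTrace τ)
    (hle : ∀ u, IsSelfAdjoint u → |(ψ (u * u)).re| ≤ (τ (u * u)).re)
    {b : B.Elem} (hb : IsSelfAdjoint b) {r : ℝ}
    (hr : ∀ c : B.UnitBall, (τ (c.1 * b)).re ≤ r) : (ψ b).re ≤ r := by
  refine le_of_forall_pos_le_add fun ε hε => ?_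
  obtain ⟨c, p, q, hc, hp, hq, h1, h2⟩ := exists_approx_abs hb hε
  have h3 := congr((τ $h2).re)
  have h4 := congr((ψ $h1).re)
  simp only [map_add, map_sub, map_smul, hτ.map_one, smul_eq_mul, mul_one, Complex.add_re,
    Complex.sub_re, Complex.ofReal_re] at h3 h4
  have h5 := hr ⟨c, hc⟩
  have h6 := (abs_le.mp (hle p hp)).2
  have h7 := (abs_le.mp (hle q hq)).1
  simp only at h5
  linarith

theorem convex_range_trace_mul {ι : Type*} (b : ι → B.Elem) :
    Convex ℝ (Set.range fun (c : B.UnitBall) (i : ι) => (τ (c.1 * b i)).re) := by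
  rintro _ ⟨⟨c, hc⟩, rfl⟩ _ ⟨⟨d, hd⟩, rfl⟩ s t hs ht hst
  refine ⟨⟨(s : ℂ) • c + (t : ℂ) • d, ?_⟩, ?_⟩
  · change ‖(s : ℂ) • (c : H →L[ℂ] H) + (t : ℂ) • (d : H →L[ℂ] H)‖ ≤ 1
    refine (norm_add_le _ _).trans ?_
    rw [norm_smul, norm_smul, Complex.norm_real, Complex.norm_real, Real.norm_of_nonneg hs,
      Real.norm_of_nonneg ht]
    exact (add_le_add (mul_le_of_le_one_right hs hc) (mul_le_of_le_one_right ht hd)).trans_eq hst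
  · ext i
    simp [add_mul]

/-- The vectors of values of τ(c ·) form a compact convex set. A functional with weights w
separating ψ from it amounts to the single self-adjoint element ∑ wᵢbᵢ, at which
`re_le_of_forall_unitBall` is contradicted. -/
theorem exists_unitBall_forall_fintype (hτ : B.IsFaithfulNormalTrace τ)
    (hle : ∀ u, IsSelfAdjoint u → |(ψ (u * u)).re| ≤ (τ (u * u)).re)
    {ι : Type*} [Fintype ι] (b : ι → B.Elem) (hb : ∀ i, IsSelfAdjoint (b i)) :
    ∃ c : B.UnitBall, ∀ i, (τ (c.1 * b i)).re = (ψ (b i)).re := by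
  classical
  have hΦ : Continuous fun (c : B.UnitBall) (i : ι) => (τ (c.1 * b i)).re :=
    continuous_pi fun b => Complex.continuous_re.comp (hτ.continuous_mul_right _)
  by_contra! hcon
  have hmem : (fun i => (ψ (b i)).re) ∉
      Set.range fun (c : B.UnitBall) (i : ι) => (τ (c.1 * b i)).re := by
    rintro ⟨c, hc⟩
    obtain ⟨i, hne⟩ := hcon c
    exact hne (congrFun hc i)
  obtain ⟨f, r, hf, hr⟩ := geometric_hahn_banach_closed_point (convex_range_trace_mul b)
    (isCompact_range hΦ).isClosed hmem
  obtain ⟨w, hw⟩ : ∃ w : ι → ℝ, ∀ x : ι → ℝ, f x = ∑ i, w i * x i :=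
    ⟨fun i => f fun j => if i = j then 1 else 0, fun x =>
      (LinearMap.pi_apply_eq_sum_univ f.toLinearMap x).trans
        (Finset.sum_congr rfl fun i _ => mul_comm _ _)⟩
  have hre : ∀ (χ : B.Elem →ₗ[ℂ] ℂ), (χ (∑ i, (w i : ℂ) • b i)).re =
      f fun i => (χ (b i)).re := fun χ => by
    simp [hw]
  have hb₀ : IsSelfAdjoint (∑ i, (w i : ℂ) • b i) := by
    rw [IsSelfAdjoint, star_sum]
    refine Finset.sum_congr rfl fun i _ => ?_
    rw [star_smul, (hb i).star_eq]
    simp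
  have h1 : (ψ (∑ i, (w i : ℂ) • b i)).re ≤ r :=
    re_le_of_forall_unitBall hτ hle hb₀ fun c =>
      (hre (τ ∘ₗ LinearMap.mulLeft ℂ c.1)).trans_le (hf _ ⟨c, rfl⟩).le
  rw [hre] at h1
  exact absurd hr h1.not_gt

/-- A hermitian functional which is dominated by a faithful normal trace `τ` has the form
`τ(c ·)`. -/
theorem exists_eq_trace_mul (hτ : B.IsFaithfulNormalTrace τ)
    (hreal : ∀ b, IsSelfAdjoint b → (ψ b).im = 0)
    (hle : ∀ u, IsSelfAdjoint u → |(ψ (u * u)).re| ≤ (τ (u * u)).re) :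
    ∃ c : B.Elem, ∀ b, ψ b = τ (c * b) := by
  obtain ⟨c, hc⟩ : ∃ c : B.UnitBall, ∀ b : selfAdjoint B.Elem,
      (τ (c.1 * b)).re = (ψ b).re := by
    -- Each self-adjoint b imposes a closed condition on c; by compactness it suffices to meet
    -- finitely many at a time.
    by_contra! hcon
    obtain ⟨F, hF⟩ := isCompact_univ.elim_finite_subfamily_closed
      (fun b : selfAdjoint B.Elem => {c : B.UnitBall | (τ (c.1 * b)).re = (ψ b).re})
      (fun b => isClosed_eq (Complex.continuous_re.comp (hτ.continuous_mul_right _))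
        continuous_const) (by
        ext c
        simpa using hcon c)
    obtain ⟨c, hc⟩ := exists_unitBall_forall_fintype hτ hle (fun b : F => b.1.1) fun b => b.1.2
    have : c ∈ (∅ : Set B.UnitBall) := by
      rw [← hF]
      exact ⟨trivial, Set.mem_iInter₂.mpr fun b hb => hc ⟨b, hb⟩⟩
    exact this
  -- Replacing c by its real part makes τ(cb) real for self-adjoint b without changing its real
  -- part, and ψ(b) is real.
  have hsa : ∀ b : selfAdjoint B.Elem,
      ψ b = τ (((2⁻¹ : ℂ) • (c.1 + star c.1)) * b) := fun b => by
    have h : τ (star c.1 * b) = star (τ (c.1 * b)) := by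
      rw [← hτ.isTracialState.map_star, star_mul, b.2.star_eq, hτ.tracial]
    rw [smul_mul_assoc, add_mul, map_smul, map_add, h]
    refine Complex.ext ?_ ?_
    · simp [hc b]
      ring
    · simp [hreal b b.2]
  refine ⟨(2⁻¹ : ℂ) • (c.1 + star c.1), fun b => ?_⟩
  rw [← realPart_add_I_smul_imaginaryPart b, map_add, map_smul, hsa, hsa, mul_add, map_add,
    mul_smul_comm, map_smul]

end RadonNikodym

/-- Test with b the square root of the negative part n of c: then bcb = -n², so τ(n²) = 0 and n = 0
by faithfulness. -/
theorem isPositive_of_forall_trace (hτ : B.IsFaithfulNormalTrace τ) {c : B.Elem}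
    (hc : IsSelfAdjoint c) (h : ∀ b, IsSelfAdjoint b → 0 ≤ (τ (b * c * b)).re) :
    (c : H →L[ℂ] H).IsPositive := by
  let n : ℝ → ℝ := fun t => max (-t) 0
  let p : ℝ → ℝ := fun t => √(n t)
  have hn : Continuous n := by fun_prop
  have hp : Continuous p := by fun_prop
  have hpn : (fun t => p t * t * p t) = fun t => 0 - n t * n t := by
    ext t
    have h1 : p t * p t = n t := Real.mul_self_sqrt (le_max_right _ _)
    have h2 : n t * t = - (n t * n t) := by
      rcases le_total t 0 with ht | ht
      · simp [n, ht]
      · simp [n, ht]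
    calc p t * t * p t = p t * p t * t := by ring
      _ = _ := by rw [h1, h2, zero_sub]
  have h1 : cfcElem p c * c * cfcElem p c = - (cfcElem n c * cfcElem n c) := by
    conv_lhs => arg 1; arg 2; rw [← cfcElem_id hc]
    rw [← cfcElem_mul hp continuous_id', ← cfcElem_mul (f := fun t => p t * t) (by fun_prop) hp,
      hpn, cfcElem_sub (g := fun t => n t * n t) (by fun_prop) (by fun_prop), cfcElem_mul hn hn,
      cfcElem_const hc]
    simp
  have h2 : τ (star (cfcElem n c) * cfcElem n c) = 0 := by
    have h3 := h _ (isSelfAdjoint_cfcElem p c)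
    rw [h1, map_neg, Complex.neg_re] at h3
    have h4 := hτ.nonneg (cfcElem n c)
    rw [(isSelfAdjoint_cfcElem n c).star_eq] at h4 ⊢
    have h5 := Complex.nonneg_iff.mp h4
    exact Complex.ext (by simp; linarith) h5.2.symm
  have h3 : c = cfcElem (fun t => t + n t) c := by
    rw [cfcElem_add continuous_id' hn, cfcElem_id hc, hτ.faithful _ h2, add_zero]
  rw [← ContinuousLinearMap.nonneg_iff_isPositive, h3]
  refine cfc_nonneg fun t _ => ?_
  linarith [le_max_left (-t) 0]

/-! ### Derivatives of vector functionals -/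

section ConditionalExpectation

variable {K : Type v} [NormedAddCommGroup K] [InnerProductSpace ℂ K] [CompleteSpace K]

/-- For self-adjoint u, `hcomm` turns ⟨ξ, Tσ(u²)ξ⟩ into ⟨σ(u)ξ, Tσ(u)ξ⟩, at most ‖T‖ τ(u²) in
modulus. Dividing by r = ‖T‖ + 1 gives a functional dominated by τ. -/
theorem exists_trace_mul_eq_inner (hτ : B.IsFaithfulNormalTrace τ)
    (σ : B.Elem →⋆ₐ[ℂ] (K →L[ℂ] K)) {ξ : K} (hξ : ∀ b, inner ℂ ξ (σ b ξ) = τ b)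
    {T : K →L[ℂ] K} (hT : IsSelfAdjoint T)
    (hcomm : ∀ b c, inner ℂ ξ (σ b (T (σ c ξ))) = inner ℂ ξ (T (σ c (σ b ξ)))) :
    ∃ c : B.Elem, ∀ b, inner ℂ ξ (T (σ b ξ)) = τ (c * b) := by
  let ψ₀ : B.Elem →ₗ[ℂ] ℂ :=
    { toFun := fun b => inner ℂ ξ (T (σ b ξ))
      map_add' := fun b c => by simp
      map_smul' := fun r b => by simp }
  let r : ℝ := ‖T‖ + 1
  have hr : 0 < r := by positivity
  let ψ : B.Elem →ₗ[ℂ] ℂ := ((r⁻¹ : ℝ) : ℂ) • ψ₀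
  have hψ : ∀ b, ψ b = ((r⁻¹ : ℝ) : ℂ) * inner ℂ ξ (T (σ b ξ)) := fun b => rfl
  have hTadj : ∀ x y, inner ℂ (T x) y = inner ℂ x (T y) := fun x y => hT.isSymmetric x y
  have hσadj : ∀ b, IsSelfAdjoint b → ∀ x y, inner ℂ (σ b x) y = inner ℂ x (σ b y) :=
    fun b hb x y => (hb.map σ).isSymmetric x y
  obtain ⟨c, hc⟩ := exists_eq_trace_mul (ψ := ψ) hτ (fun b hb => by
    rw [hψ, Complex.im_ofReal_mul, mul_eq_zero]
    right
    rw [← Complex.conj_eq_iff_im, inner_conj_symm, hTadj, hσadj b hb]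
    have := hcomm b 1
    simp only [map_one, one_apply_eq_self] at this
    rw [this]) (fun u hu => by
    have h1 : inner ℂ ξ (T (σ (u * u) ξ)) = inner ℂ (σ u ξ) (T (σ u ξ)) := by
      rw [hσadj u hu, hcomm, map_mul]; rfl
    have h2 : τ (u * u) = ((‖σ u ξ‖ ^ 2 : ℝ) : ℂ) := by
      rw [← hξ, map_mul, mul_apply_eq_comp, ← hσadj u hu, inner_self_eq_norm_sq_to_K]
      simp
    rw [h2, Complex.ofReal_re]
    refine (Complex.abs_re_le_norm _).trans ?_
    rw [hψ, h1, norm_mul, Complex.norm_real, Real.norm_of_nonneg (by positivity),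
      inv_mul_le_iff₀ hr, sq, ← mul_assoc]
    refine (norm_inner_le_norm _ _).trans ?_
    rw [mul_comm]
    gcongr
    refine (T.le_opNorm _).trans ?_
    gcongr
    simp [r])
  refine ⟨(r : ℂ) • c, fun b => ?_⟩
  rw [smul_mul_assoc, map_smul, ← hc, hψ, smul_eq_mul, ← mul_assoc, ← Complex.ofReal_mul,
    mul_inv_cancel₀ hr.ne', Complex.ofReal_one, one_mul]

end ConditionalExpectation

end VonNeumannAlgebra

/-! ### Boundedness of left multiplications -/

/-- Taking 2^k-th roots removes the constant: if x / y > 1, its powers exceed c. -/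
theorem le_of_forall_pow_two_pow_le {x y c : ℝ} (hy : 0 ≤ y)
    (h : ∀ k : ℕ, x ^ 2 ^ k ≤ y ^ 2 ^ k * c) : x ≤ y := by
  rcases hy.eq_or_lt with rfl | hy
  · simpa using h 0
  by_contra! hlt
  have h1 : 1 < x / y := (one_lt_div hy).mpr hlt
  obtain ⟨n, hn⟩ := pow_unbounded_of_one_lt c h1
  have h2 : (x / y) ^ n ≤ (x / y) ^ 2 ^ n := pow_le_pow_right₀ h1.le Nat.lt_two_pow_self.le
  have h3 := h n
  rw [mul_comm, ← div_le_iff₀ (by positivity), ← div_pow] at h3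
  linarith

namespace IsTracialState

variable {P : Type u} [Ring P] [StarRing P] [Algebra ℂ P] [StarModule ℂ P] {φ : P →ₗ[ℂ] ℂ}

/-- By traciality the value is φ(y^m pp*), and Cauchy–Schwarz separates the moment φ(y^(2m)) from a
factor independent of m. -/
theorem norm_apply_star_mul_pow_mul_le (hφ : IsTracialState φ) {y : P} (hy : IsSelfAdjoint y)
    {r : ℝ} (hr : 0 ≤ r) (h : ∀ m : ℕ, ‖φ (y ^ m)‖ ≤ r ^ m) (p : P) (m : ℕ) :
    ‖φ (star p * y ^ m * p)‖ ≤ r ^ m * √(φ (star (p * star p) * (p * star p))).re := by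
  have h1 := hφ.norm_apply_star_mul_sq_le (y ^ m) (p * star p)
  rw [(hy.pow m).star_eq, ← pow_add, ← two_mul, pow_mul'] at h1
  have h2 : φ (star p * y ^ m * p) = φ (y ^ m * (p * star p)) := by
    rw [mul_assoc, hφ.tracial, mul_assoc]
  have h3 : 0 ≤ (φ (star (p * star p) * (p * star p))).re :=
    (Complex.nonneg_iff.mp (hφ.nonneg _)).1
  rw [h2, ← sq_le_sq₀ (norm_nonneg _) (by positivity), mul_pow, Real.sq_sqrt h3]
  refine h1.trans ?_
  gcongr
  refine (Complex.re_le_norm _).trans ?_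
  rw [← pow_mul', ← pow_mul']
  exact h _

/-- A self-adjoint element whose moments grow at most like `r ^ m` is bounded by `r` in the GNS
representation. -/
theorem norm_apply_star_mul_mul_le (hφ : IsTracialState φ) {y : P} (hy : IsSelfAdjoint y)
    {r : ℝ} (hr : 0 ≤ r) (h : ∀ m : ℕ, ‖φ (y ^ m)‖ ≤ r ^ m) (p : P) :
    ‖φ (star p * y * p)‖ ≤ r * (φ (star p * p)).re := by
  set s := (φ (star p * p)).re with hs
  have hs0 : 0 ≤ s := (Complex.nonneg_iff.mp (hφ.nonneg _)).1
  have hstep : ∀ m : ℕ, ‖φ (star p * y ^ m * p)‖ ^ 2 ≤ s * ‖φ (star p * y ^ (2 * m) * p)‖ := by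
    intro m
    have h1 := hφ.norm_apply_star_mul_sq_le p (y ^ m * p)
    rw [star_mul, (hy.pow m).star_eq] at h1
    have h2 : star p * y ^ m * (y ^ m * p) = star p * y ^ (2 * m) * p := by
      rw [two_mul, pow_add]
      simp only [mul_assoc]
    rw [h2, ← mul_assoc] at h1
    exact h1.trans (by gcongr; exact Complex.re_le_norm _)
  rcases hs0.eq_or_lt with h0 | hpos
  · have := hstep 1
    rw [← h0, zero_mul, pow_one] at this
    rw [← h0, mul_zero]
    exact (pow_eq_zero_iff two_ne_zero).mp (le_antisymm this (by positivity)) |>.le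
  -- Iterating `hstep` doubles the exponent each time. The extra factor s on the left avoids the
  -- exponent 2^k - 1.
  have hind : ∀ k : ℕ, ‖φ (star p * y * p)‖ ^ 2 ^ k * s ≤
      s ^ 2 ^ k * ‖φ (star p * y ^ 2 ^ k * p)‖ := by
    intro k
    induction k with
    | zero => simp [mul_comm]
    | succ k ih =>
      refine le_of_mul_le_mul_right ?_ hpos
      calc _ = (‖φ (star p * y * p)‖ ^ 2 ^ k * s) ^ 2 := by ring
        _ ≤ (s ^ 2 ^ k * ‖φ (star p * y ^ 2 ^ k * p)‖) ^ 2 := by gcongr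
        _ = s ^ 2 ^ (k + 1) * ‖φ (star p * y ^ 2 ^ k * p)‖ ^ 2 := by ring
        _ ≤ s ^ 2 ^ (k + 1) * (s * ‖φ (star p * y ^ (2 * 2 ^ k) * p)‖) := by
          gcongr
          exact hstep _
        _ = _ := by rw [← pow_succ']; ring
  refine le_of_forall_pow_two_pow_le (c := √(φ (star (p * star p) * (p * star p))).re / s)
    (by positivity) fun k => ?_
  rw [← mul_div_assoc, le_div_iff₀ hpos]
  refine (hind k).trans ?_
  have h1 := hφ.norm_apply_star_mul_pow_mul_le hy hr h p (2 ^ k)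
  calc _ ≤ s ^ 2 ^ k * (r ^ 2 ^ k * √(φ (star (p * star p) * (p * star p))).re) := by gcongr
    _ = _ := by ring

theorem isBounded_of_norm_toPreGNS_mul_le (hφ : IsTracialState φ)
    (h : ∀ p, ∃ c : ℝ, ∀ q, ‖hφ.toPreGNS (p * q)‖ ≤ c * ‖hφ.toPreGNS q‖) : IsBounded φ := by
  intro p
  obtain ⟨c, hc⟩ := h p
  refine ⟨c ^ 2, fun q => ?_⟩
  rw [← hφ.norm_sq_toPreGNS, ← hφ.norm_sq_toPreGNS, Complex.ofReal_re, Complex.ofReal_re,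
    ← mul_pow]
  gcongr
  exact hc q

theorem norm_toPreGNS_mul_le_of_re_le (hφ : IsTracialState φ) {p : P} {c : ℝ} (hc : 0 ≤ c)
    (h : ∀ q, (φ (star q * (star p * p) * q)).re ≤ c ^ 2 * (φ (star q * q)).re) (q : P) :
    ‖hφ.toPreGNS (p * q)‖ ≤ c * ‖hφ.toPreGNS q‖ := by
  have h1 := h q
  rw [← sq_le_sq₀ (by positivity) (by positivity), mul_pow]
  have h2 : star q * (star p * p) * q = star (p * q) * (p * q) := by
    rw [star_mul]
    simp only [mul_assoc]
  rwa [h2, ← hφ.norm_sq_toPreGNS, ← hφ.norm_sq_toPreGNS, Complex.ofReal_re,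
    Complex.ofReal_re] at h1

end IsTracialState

namespace VonNeumannAlgebra

variable {H : Type u} [NormedAddCommGroup H] [InnerProductSpace ℂ H] [CompleteSpace H]
  {B : VonNeumannAlgebra H} {τ : B.Elem →ₗ[ℂ] ℂ}

theorem exists_mul_self_eq {b : B.Elem} (hb : 0 ≤ (b : H →L[ℂ] H)) :
    ∃ d : B.Elem, IsSelfAdjoint d ∧ d * d = b := by
  refine ⟨⟨CFC.sqrt (b : H →L[ℂ] H), mem_of_forall_commute fun y hy => ?_⟩, ?_, ?_⟩
  · exact Commute.cfcₙ_nnreal (hy _ b.2) _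
  · exact Subtype.ext (CFC.sqrt_nonneg (b : H →L[ℂ] H)).isSelfAdjoint
  · exact Subtype.ext (CFC.sqrt_mul_sqrt_self (b : H →L[ℂ] H))

/-- Positivity of τ and φ is available only on elements of the form q*q; the root d brings b ≤ ‖b‖
into that form. -/
theorem exists_norm_smul_one_sub_eq {b : B.Elem} (hb : IsSelfAdjoint b) :
    ∃ d : B.Elem, IsSelfAdjoint d ∧ d * d = ((‖(b : H →L[ℂ] H)‖ : ℝ) : ℂ) • 1 - b := by
  refine exists_mul_self_eq ?_
  have h := (isSelfAdjoint_coe hb).le_algebraMap_norm_self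
  rw [← sub_nonneg, Algebra.algebraMap_eq_smul_one] at h
  exact h

theorem norm_star_mul_self_coe (b : B.Elem) :
    ‖((star b * b : B.Elem) : H →L[ℂ] H)‖ = ‖(b : H →L[ℂ] H)‖ ^ 2 :=
  (CStarRing.norm_star_mul_self (x := (b : H →L[ℂ] H))).trans (sq _).symm

theorem IsFaithfulNormalTrace.norm_apply_le (hτ : B.IsFaithfulNormalTrace τ) (b : B.Elem) :
    ‖τ b‖ ≤ ‖(b : H →L[ℂ] H)‖ := by
  have h1 := hτ.isTracialState.norm_apply_star_mul_sq_le 1 b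
  rw [star_one, one_mul, one_mul, hτ.map_one, Complex.one_re, one_mul] at h1
  obtain ⟨d, hd, hdd⟩ := exists_norm_smul_one_sub_eq (IsSelfAdjoint.star_mul_self b)
  have h2 := (Complex.nonneg_iff.mp (hτ.nonneg d)).1
  rw [hd.star_eq, hdd, map_sub, map_smul, hτ.map_one, norm_star_mul_self_coe] at h2
  simp only [smul_eq_mul, mul_one, Complex.sub_re, Complex.ofReal_re, sub_nonneg] at h2
  exact (sq_le_sq₀ (norm_nonneg _) (norm_nonneg _)).mp (h1.trans h2)

/-! ### Distributions with tracial composition `τ ∘ μ` -/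

variable {μ : NCPoly B.Elem →ₗ[ℂ] B.Elem}

theorem IsDistribution.nonneg_trace (hμ : B.IsDistribution μ) (hτ : B.IsFaithfulNormalTrace τ)
    (P : NCPoly B.Elem) : 0 ≤ τ (μ (star P * P)) := by
  obtain ⟨Y, hY⟩ := hμ.completelyPositive 1 fun _ => P
  have h := congr($hY 0 0)
  simp only [Matrix.of_apply, Matrix.mul_apply, Finset.univ_unique, Finset.sum_singleton,
    Matrix.conjTranspose_apply] at h
  rw [h]
  exact hτ.nonneg _

theorem IsDistribution.isTracialState (hμ : B.IsDistribution μ)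
    (hτ : B.IsFaithfulNormalTrace τ)
    (h : ∀ P Q : NCPoly B.Elem, τ (μ (P * Q)) = τ (μ (Q * P))) : IsTracialState (τ ∘ₗ μ) where
  map_one := by rw [LinearMap.comp_apply, hμ.map_one, hτ.map_one]
  nonneg := hμ.nonneg_trace hτ
  tracial := h

theorem ExpBoundedBy.nonneg {M : ℝ} (h : B.ExpBoundedBy μ M) : 0 ≤ M := by
  simpa using (norm_nonneg _).trans (h [])

theorem ExpBoundedBy.norm_trace_pow_le {M : ℝ} (h : B.ExpBoundedBy μ M)
    (hμ : B.IsDistribution μ) (hτ : B.IsFaithfulNormalTrace τ) (m : ℕ) :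
    ‖τ (μ (NCPoly.X ^ m))‖ ≤ M ^ m := by
  cases m with
  | zero => simp [hμ.map_one, hτ.map_one]
  | succ n =>
    refine (hτ.norm_apply_le _).trans ?_
    -- X^(n+1) has n gaps between its letters, each filled with the coefficient 1.
    have h1 := h (List.replicate n 1)
    simp only [List.map_replicate, List.prod_replicate, map_one, one_mul,
      List.length_replicate] at h1
    rw [pow_succ']
    refine h1.trans (mul_le_of_le_one_right (pow_nonneg h.nonneg _) ?_)
    exact pow_le_one₀ (norm_nonneg _) ContinuousLinearMap.norm_id_le

theorem isSelfAdjoint_X : IsSelfAdjoint (NCPoly.X : NCPoly B.Elem) := NCPoly.star_X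

theorem ExpBoundedBy.trace_star_mul_X_mul_le {M : ℝ} (h : B.ExpBoundedBy μ M)
    (hμ : B.IsDistribution μ) (hτ : B.IsFaithfulNormalTrace τ)
    (hφ : IsTracialState (τ ∘ₗ μ)) (P : NCPoly B.Elem) :
    τ (μ (star P * NCPoly.X * P)) ≤ (M : ℂ) * τ (μ (star P * P)) := by
  have h1 := hφ.norm_apply_star_mul_mul_le isSelfAdjoint_X h.nonneg
    (h.norm_trace_pow_le hμ hτ) P
  -- An inequality in ℂ includes equality of imaginary parts, so the left side must first be shown
  -- real.
  have h2 := hφ.map_star (star P * NCPoly.X * P)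
  have h3 : star (star P * NCPoly.X * P) = star P * NCPoly.X * P := by
    simp [mul_assoc]
  rw [h3] at h2
  have h4 := hφ.ofReal_re_apply_star_mul_self P
  simp only [LinearMap.comp_apply] at h1 h2 h4
  rw [← Complex.conj_eq_iff_re.mp h2.symm, ← h4, ← Complex.ofReal_mul, Complex.real_le_real]
  exact (Complex.re_le_norm _).trans h1

theorem trace_mul_C (hμ : B.IsDistribution μ) (P : NCPoly B.Elem) (b : B.Elem) :
    μ (P * NCPoly.C b) = μ P * b := by
  have h := hμ.bimodular 1 P b
  rwa [map_one, one_mul, one_mul] at h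

/-- Boundedness passes to sums and products, so constants and X suffice. For X the bound on ‖Xq‖²
comes from the moments of X², which grow at most like (M²)^m. -/
theorem ExpBoundedBy.isBounded {M : ℝ} (h : B.ExpBoundedBy μ M)
    (hμ : B.IsDistribution μ) (hτ : B.IsFaithfulNormalTrace τ)
    (hφ : IsTracialState (τ ∘ₗ μ)) : IsTracialState.IsBounded (τ ∘ₗ μ) := by
  refine hφ.isBounded_of_norm_toPreGNS_mul_le fun P => ?_
  induction P using NCPoly.induction with
  | hC b =>
    refine ⟨‖(b : H →L[ℂ] H)‖, hφ.norm_toPreGNS_mul_le_of_re_le (norm_nonneg _) fun Q => ?_⟩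
    obtain ⟨d, hd, hdd⟩ := exists_norm_smul_one_sub_eq (IsSelfAdjoint.star_mul_self b)
    have h1 := (Complex.nonneg_iff.mp (hφ.nonneg (NCPoly.C d * Q))).1
    have h2 : star (NCPoly.C d * Q) * (NCPoly.C d * Q) = star Q * NCPoly.C (d * d) * Q := by
      rw [star_mul, NCPoly.star_C, hd.star_eq, map_mul]
      simp only [mul_assoc]
    rw [h2, hdd, map_sub, map_smul, map_one, norm_star_mul_self_coe, mul_sub, sub_mul,
      mul_smul_comm, smul_mul_assoc, mul_one, map_sub, map_smul, smul_eq_mul, Complex.sub_re,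
      Complex.re_ofReal_mul, sub_nonneg,
      map_mul (NCPoly.C (R := B.Elem)), ← NCPoly.star_C] at h1
    exact h1
  | hX =>
    refine ⟨M, hφ.norm_toPreGNS_mul_le_of_re_le h.nonneg fun Q => ?_⟩
    rw [isSelfAdjoint_X.star_eq, ← sq]
    refine (Complex.re_le_norm _).trans
      (hφ.norm_apply_star_mul_mul_le (isSelfAdjoint_X.pow 2) (sq_nonneg M) (fun m => ?_) Q)
    rw [← pow_mul, ← pow_mul]
    exact h.norm_trace_pow_le hμ hτ _
  | hadd P Q hP hQ =>
    obtain ⟨c, hc⟩ := hP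
    obtain ⟨d, hd⟩ := hQ
    refine ⟨c + d, fun R => ?_⟩
    rw [add_mul, map_add, add_mul]
    exact (norm_add_le _ _).trans (add_le_add (hc R) (hd R))
  | hmul P Q hP hQ =>
    obtain ⟨c, hc⟩ := hP
    obtain ⟨d, hd⟩ := hQ
    refine ⟨|c| * d, fun R => ?_⟩
    rw [mul_assoc, mul_assoc]
    refine (hc _).trans ?_
    refine (mul_le_mul_of_nonneg_right (le_abs_self c) (norm_nonneg _)).trans ?_
    gcongr
    exact hd R

end VonNeumannAlgebra

/-! ### B as a von Neumann subalgebra of an algebra with a vector trace -/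

namespace VonNeumannAlgebra

variable {H : Type u} [NormedAddCommGroup H] [InnerProductSpace ℂ H] [CompleteSpace H]
  {B : VonNeumannAlgebra H} {τ : B.Elem →ₗ[ℂ] ℂ}

theorem eq_of_forall_trace_mul_eq (hτ : B.IsFaithfulNormalTrace τ) {c d : B.Elem}
    (h : ∀ b, τ (c * b) = τ (d * b)) : c = d := by
  refine sub_eq_zero.mp (hτ.faithful _ ?_)
  rw [hτ.tracial, sub_mul, map_sub, h, sub_self]

/-- As S is closed under adjoints, the orthogonal complement of L is invariant as well. -/
theorem starProjection_mem_centralizer {K : Type*} [NormedAddCommGroup K] [InnerProductSpace ℂ K]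
    [CompleteSpace K] {S : Set (K →L[ℂ] K)} (hS : ∀ s ∈ S, star s ∈ S) (L : Submodule ℂ K)
    [L.HasOrthogonalProjection] (hL : ∀ s ∈ S, ∀ x ∈ L, s x ∈ L) :
    L.starProjection ∈ Set.centralizer S := by
  intro s hs
  ext x
  change s (L.starProjection x) = L.starProjection (s x)
  symm
  refine Submodule.eq_starProjection_of_mem_orthogonal (hL s hs _ (by simp)) ?_
  rw [← map_sub]
  refine (L.mem_orthogonal' _).mpr fun y hy => ?_
  rw [← ContinuousLinearMap.adjoint_inner_right, ← ContinuousLinearMap.star_eq_adjoint]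
  exact (L.mem_orthogonal' _).mp (Submodule.sub_starProjection_mem_orthogonal x) _
    (hL _ (hS s hs) y hy)

section VectorTrace

variable {K : Type u} [NormedAddCommGroup K] [InnerProductSpace ℂ K] [CompleteSpace K]
  {A : VonNeumannAlgebra K} {tr : A.Elem →ₗ[ℂ] ℂ} {ι : B.Elem →⋆ₐ[ℂ] A.Elem}

theorem exists_trace_mul_eq (hτ : B.IsFaithfulNormalTrace τ) (htr : A.IsFaithfulNormalTrace tr)
    (hι : ∀ b, tr (ι b) = τ b) {ξ : K} (hξ : ∀ a : A.Elem, tr a = inner ℂ ξ ((a : K →L[ℂ] K) ξ))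
    (a : A.Elem) : ∃ c : B.Elem, ∀ b, tr (a * ι b) = τ (c * b) := by
  have key : ∀ a : A.Elem, IsSelfAdjoint a →
      ∃ c : B.Elem, ∀ b, tr (a * ι b) = τ (c * b) := fun a ha => by
    obtain ⟨c, hc⟩ := exists_trace_mul_eq_inner hτ (A.toStarSubalgebra.subtype.comp ι) (ξ := ξ)
      (fun b => (hξ _).symm.trans (hι b)) (isSelfAdjoint_coe ha)
      fun b c => ((hξ (ι b * (a * ι c))).symm.trans
        (by rw [htr.tracial, mul_assoc])).trans (hξ (a * (ι c * ι b)))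
    exact ⟨c, fun b => (hξ _).trans (hc b)⟩
  obtain ⟨c, hc⟩ := key _ (realPart a).2
  obtain ⟨d, hd⟩ := key _ (imaginaryPart a).2
  refine ⟨c + Complex.I • d, fun b => ?_⟩
  conv_lhs => rw [← realPart_add_I_smul_imaginaryPart a]
  rw [add_mul, add_mul, map_add, map_add, hc, smul_mul_assoc, smul_mul_assoc, map_smul, map_smul,
    hd]

theorem eq_of_apply_eq (htr : A.IsFaithfulNormalTrace tr) {ξ : K}
    (hξ : ∀ a : A.Elem, tr a = inner ℂ ξ ((a : K →L[ℂ] K) ξ)) {a b : A.Elem}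
    (h : (a : K →L[ℂ] K) ξ = (b : K →L[ℂ] K) ξ) : a = b := by
  refine sub_eq_zero.mp (htr.faithful _ ((hξ _).trans ?_))
  change inner ℂ ξ ((star (a - b) : A.Elem).1 ((a : K →L[ℂ] K) ξ - (b : K →L[ℂ] K) ξ)) = 0
  rw [h, sub_self, map_zero, inner_zero_right]

theorem apply_mem_closure (ξ : K) (b : B.Elem) {x : K}
    (hx : x ∈ closure (Set.range fun b => (ι b : K →L[ℂ] K) ξ)) :
    (ι b : K →L[ℂ] K) x ∈ closure (Set.range fun b => (ι b : K →L[ℂ] K) ξ) := by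
  refine map_mem_closure (ContinuousLinearMap.continuous _) hx ?_
  rintro _ ⟨d, rfl⟩
  exact ⟨b * d, congrArg (fun a : A.Elem => (a : K →L[ℂ] K) ξ) (map_mul ι b d)⟩

/-- The projection onto the closure of Bξ commutes with B, hence with T, and it fixes ξ. -/
theorem apply_mem_closure_of_mem_centralizer_centralizer {ξ : K} {T : K →L[ℂ] K}
    (hT : T ∈ Set.centralizer (Set.centralizer (Set.range fun b => (ι b : K →L[ℂ] K)))) :
    T ξ ∈ closure (Set.range fun b => (ι b : K →L[ℂ] K) ξ) := by
  let L₀ : Submodule ℂ K := LinearMap.range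
    ({ toFun := fun b => (ι b : K →L[ℂ] K) ξ
       map_add' := fun b c => by rw [map_add]; rfl
       map_smul' := fun r b => by rw [map_smul]; rfl } : B.Elem →ₗ[ℂ] K)
  let L := L₀.topologicalClosure
  have : CompleteSpace L := L₀.isClosed_topologicalClosure.completeSpace_coe
  have he : L.starProjection ∈ Set.centralizer (Set.range fun b => (ι b : K →L[ℂ] K)) := by
    refine starProjection_mem_centralizer ?_ L ?_
    · rintro _ ⟨b, rfl⟩
      exact ⟨star b, congrArg Subtype.val (map_star ι b)⟩
    · rintro _ ⟨b, rfl⟩ x hx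
      exact apply_mem_closure ξ b hx
  have hξL : ξ ∈ L := L₀.le_topologicalClosure
    ⟨1, by rw [LinearMap.coe_mk, AddHom.coe_mk, map_one]; rfl⟩
  have h := congr($(hT _ he) ξ)
  rw [mul_apply_eq_comp, mul_apply_eq_comp, Submodule.starProjection_eq_self_iff.mpr hξL] at h
  exact Submodule.starProjection_eq_self_iff.mp h

/-- For T in the bicommutant let c be its derivative. Then (T - c)ξ lies in the closure of Bξ and is
orthogonal to Bξ, so it vanishes; ξ separates A, so T = c. -/
theorem centralizer_centralizer_range_eq (hτ : B.IsFaithfulNormalTrace τ)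
    (htr : A.IsFaithfulNormalTrace tr) (hι : ∀ b, tr (ι b) = τ b) {ξ : K}
    (hξ : ∀ a : A.Elem, tr a = inner ℂ ξ ((a : K →L[ℂ] K) ξ)) :
    Set.centralizer (Set.centralizer (Set.range fun b => (ι b : K →L[ℂ] K)))
      = Set.range fun b => (ι b : K →L[ℂ] K) := by
  refine Set.Subset.antisymm (fun T hT => ?_) Set.subset_centralizer_centralizer
  have hTA : T ∈ A.toStarSubalgebra := by
    rw [mem_carrier, ← centralizer_centralizer]
    refine Set.centralizer_subset (Set.centralizer_subset ?_) hT
    rintro _ ⟨b, rfl⟩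
    exact (ι b).2
  obtain ⟨c, hc⟩ := exists_trace_mul_eq hτ htr hι hξ ⟨T, hTA⟩
  have hmem : T ξ - (ι c : K →L[ℂ] K) ξ ∈ closure (Set.range fun b => (ι b : K →L[ℂ] K) ξ) := by
    have hTc : T - (ι c : K →L[ℂ] K) ∈
        Set.centralizer (Set.centralizer (Set.range fun b => (ι b : K →L[ℂ] K))) :=
      fun y hy => by rw [mul_sub, sub_mul, hT y hy, ← hy _ ⟨c, rfl⟩]
    exact apply_mem_closure_of_mem_centralizer_centralizer hTc
  have horth : ∀ x ∈ closure (Set.range fun b => (ι b : K →L[ℂ] K) ξ),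
      inner ℂ x (T ξ - (ι c : K →L[ℂ] K) ξ) = 0 := fun x hx => by
    refine closure_minimal (t := {x | inner ℂ x (T ξ - (ι c : K →L[ℂ] K) ξ) = 0}) ?_
      (isClosed_eq (by fun_prop) continuous_const) hx
    rintro _ ⟨b, rfl⟩
    have h : tr (ι (star b) * (⟨T, hTA⟩ - ι c)) = 0 := by
      rw [htr.tracial, sub_mul, map_sub, hc, ← map_mul ι, hι, sub_self]
    rw [hξ, map_star] at h
    rw [Set.mem_ofPred_eq, ← ContinuousLinearMap.adjoint_inner_right]
    exact h
  have h := sub_eq_zero.mp (inner_self_eq_zero.mp (horth _ hmem))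
  exact ⟨c, congrArg Subtype.val (eq_of_apply_eq htr hξ (a := ⟨T, hTA⟩) h).symm⟩

end VectorTrace

/-! ### The conditional expectation onto B -/

section Construction

variable (hτ : B.IsFaithfulNormalTrace τ) {K : Type u} [NormedAddCommGroup K]
  [InnerProductSpace ℂ K] [CompleteSpace K] {A : VonNeumannAlgebra K} {tr : A.Elem →ₗ[ℂ] ℂ}
  {ι : B.Elem →⋆ₐ[ℂ] A.Elem}
  (hE : ∀ a : A.Elem, ∃ c : B.Elem, ∀ b, tr (a * ι b) = τ (c * b))

/-- The conditional expectation which is given by Radon–Nikodym derivatives. -/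
noncomputable def condExp : A.Elem →ₗ[ℂ] B.Elem where
  toFun a := (hE a).choose
  map_add' a b := eq_of_forall_trace_mul_eq hτ fun c => by
    rw [add_mul, map_add, ← (hE _).choose_spec, ← (hE _).choose_spec, ← (hE _).choose_spec,
      add_mul, map_add]
  map_smul' r a := eq_of_forall_trace_mul_eq hτ fun c => by
    rw [RingHom.id_apply, smul_mul_assoc, map_smul, ← (hE _).choose_spec,
      ← (hE _).choose_spec, smul_mul_assoc, map_smul]

theorem trace_condExp_mul (a : A.Elem) (b : B.Elem) :
    τ (condExp hτ hE a * b) = tr (a * ι b) :=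
  ((hE a).choose_spec b).symm

theorem star_condExp (htr : A.IsFaithfulNormalTrace tr) (a : A.Elem) :
    star (condExp hτ hE a) = condExp hτ hE (star a) :=
  eq_of_forall_trace_mul_eq hτ fun b => by
    rw [trace_condExp_mul, hτ.tracial, ← star_star b, ← star_mul, hτ.isTracialState.map_star,
      trace_condExp_mul, ← htr.isTracialState.map_star, star_mul, star_star, map_star, star_star,
      htr.tracial]

/-- For self-adjoint b, τ(b E(a*a) b) = tr((ab)*(ab)) ≥ 0, which is the test of
`isPositive_of_forall_trace`. -/
theorem isPositive_condExp_star_mul_self (htr : A.IsFaithfulNormalTrace tr) (a : A.Elem) :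
    (condExp hτ hE (star a * a) : H →L[ℂ] H).IsPositive := by
  refine isPositive_of_forall_trace hτ ?_ fun b hb => ?_
  · rw [IsSelfAdjoint, star_condExp hτ hE htr, star_mul, star_star]
  · rw [mul_assoc, hτ.tracial, mul_assoc, trace_condExp_mul, map_mul ι]
    have h := (Complex.nonneg_iff.mp (htr.nonneg (a * ι b))).1
    rw [star_mul, ← map_star, hb.star_eq, mul_assoc, htr.tracial] at h
    simpa only [mul_assoc] using h

theorem condExp_bimodular (htr : A.IsFaithfulNormalTrace tr) (b : B.Elem) (a : A.Elem)
    (c : B.Elem) : condExp hτ hE (ι b * a * ι c) = b * condExp hτ hE a * c :=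
  eq_of_forall_trace_mul_eq hτ fun d => by
    have h : b * condExp hτ hE a * c * d = b * (condExp hτ hE a * (c * d)) := by
      simp only [mul_assoc]
    rw [trace_condExp_mul, h, hτ.tracial, mul_assoc (condExp hτ hE a), trace_condExp_mul, mul_assoc,
      mul_assoc, htr.tracial, map_mul ι, map_mul ι]
    simp only [mul_assoc]

/-- A von Neumann algebra `A` with a faithful normal trace given by a vector `ξ` is a tracial
probability space over `B` if it contains `B` with its trace. -/
noncomputable def TracialProbabilitySpace.ofVectorTrace (htr : A.IsFaithfulNormalTrace tr)
    (hι : ∀ b, tr (ι b) = τ b) {ξ : K}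
    (hξ : ∀ a : A.Elem, tr a = inner ℂ ξ ((a : K →L[ℂ] K) ξ)) : TracialProbabilitySpace B τ where
  K := K
  A := A
  tr := tr
  isTrace := htr
  incl := ι
  incl_injective := by
    refine (injective_iff_map_eq_zero ι).mpr fun b hb => hτ.faithful b ?_
    rw [← hι, map_mul ι, hb, mul_zero, map_zero]
  range_incl := centralizer_centralizer_range_eq hτ htr hι hξ
  tr_incl := hι
  E := condExp hτ (exists_trace_mul_eq hτ htr hι hξ)
  E_incl b := eq_of_forall_trace_mul_eq hτ fun c => by
    rw [trace_condExp_mul, ← map_mul ι, hι]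
  E_bimodular := condExp_bimodular hτ _ htr
  E_positive := isPositive_condExp_star_mul_self hτ _ htr
  τ_E a := by
    rw [← mul_one (condExp hτ _ a), trace_condExp_mul, map_one, mul_one]

end Construction

/-! ### Realization of the distribution -/

section GNS

variable {μ : NCPoly B.Elem →ₗ[ℂ] B.Elem}

/-- The constants, as a `*`-homomorphism. -/
noncomputable def constHom : B.Elem →⋆ₐ[ℂ] NCPoly B.Elem where
  toAlgHom := NCPoly.C
  map_star' b := (NCPoly.star_C b).symm

/-- Every homomorphism out of B⟨X⟩ is an evaluation; this gives a representation the form P ↦ P(a).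
-/
theorem eval_comp_C {S : Type*} [Ring S] [Algebra ℂ S] (f : NCPoly B.Elem →ₐ[ℂ] S)
    (P : NCPoly B.Elem) : NCPoly.eval (f.comp NCPoly.C) (f NCPoly.X) P = f P := by
  induction P using NCPoly.induction with
  | hC b => rw [NCPoly.eval_C]; rfl
  | hX => rw [NCPoly.eval_X]
  | hadd P Q hP hQ => rw [map_add, map_add, hP, hQ]
  | hmul P Q hP hQ => rw [map_mul, map_mul, hP, hQ]

/-- A representation of `B⟨X⟩` in a von Neumann algebra with a vector trace, such that the trace
restricts to `τ ∘ μ`, realizes the distribution `μ`. -/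
theorem mem_sigmaTau_of_vectorTrace (hτ : B.IsFaithfulNormalTrace τ) (hμ : μ ∈ B.Sigma0)
    {K : Type u} [NormedAddCommGroup K] [InnerProductSpace ℂ K] [CompleteSpace K]
    {A : VonNeumannAlgebra K} {tr : A.Elem →ₗ[ℂ] ℂ} (htr : A.IsFaithfulNormalTrace tr) {ξ : K}
    (hξ : ∀ a : A.Elem, tr a = inner ℂ ξ ((a : K →L[ℂ] K) ξ))
    (ρ : NCPoly B.Elem →⋆ₐ[ℂ] A.Elem) (hρ : ∀ P, tr (ρ P) = τ (μ P)) : μ ∈ B.SigmaTau τ := by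
  have hι : ∀ b, tr (ρ.comp constHom b) = τ b := fun b => by
    refine (hρ (NCPoly.C b)).trans ?_
    rw [← one_mul (NCPoly.C b), trace_mul_C hμ.1, hμ.1.map_one, one_mul]
  refine ⟨hμ, TracialProbabilitySpace.ofVectorTrace hτ htr hι hξ, ρ NCPoly.X,
    isSelfAdjoint_X.map ρ, fun P => ?_⟩
  -- By right B-linearity of μ, τ(μ(P)b) = τ(μ(Pb)) = tr(ρ(P)ρ(b)), and this trace identity
  -- characterizes E(ρ(P)).
  refine (eq_of_forall_trace_mul_eq hτ fun b => ?_).trans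
    (congrArg (condExp hτ (exists_trace_mul_eq hτ htr hι hξ))
      (eval_comp_C (ρ : NCPoly B.Elem →ₐ[ℂ] A.Elem) P).symm)
  rw [trace_condExp_mul, ← trace_mul_C hμ.1, ← hρ, map_mul ρ]
  rfl

theorem mem_sigmaTau_of_isTracialState (hτ : B.IsFaithfulNormalTrace τ) (hμ : μ ∈ B.Sigma0)
    (hφ : IsTracialState (τ ∘ₗ μ)) : μ ∈ B.SigmaTau τ := by
  obtain ⟨M, hM⟩ := hμ.2
  have hb := hM.isBounded hμ.1 hτ hφ
  exact mem_sigmaTau_of_vectorTrace hτ hμ (hφ.isFaithfulNormalTrace_gnsTrace hb)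
    (fun _ => rfl) (hφ.gnsHom hb) hφ.gnsTrace_gnsHom

end GNS

theorem trace_mul_comm_of_mem_sigmaTau {μ : NCPoly B.Elem →ₗ[ℂ] B.Elem}
    (h : μ ∈ B.SigmaTau τ) (P Q : NCPoly B.Elem) : τ (μ (P * Q)) = τ (μ (Q * P)) := by
  obtain ⟨-, S, a, -, hS⟩ := h
  rw [hS, hS, S.τ_E, S.τ_E, map_mul (NCPoly.eval _ _), map_mul (NCPoly.eval _ _),
    S.isTrace.tracial]

end VonNeumannAlgebra

/-! ### The characterization -/

theorem theorem4p4 {H : Type u} [NormedAddCommGroup H] [InnerProductSpace ℂ H] [CompleteSpace H]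
    (B : VonNeumannAlgebra H) (τ : B.Elem →ₗ[ℂ] ℂ) (hτ : B.IsFaithfulNormalTrace τ)
    (μ : NCPoly B.Elem →ₗ[ℂ] B.Elem) (hμ : μ ∈ B.Sigma0) :
    (μ ∈ B.SigmaTau τ ↔
      (∃ M : ℝ, ∀ P : NCPoly B.Elem,
        τ (μ (star P * NCPoly.X * P)) ≤ (M : ℂ) * τ (μ (star P * P))) ∧
      (∀ P Q : NCPoly B.Elem,
        ((‖τ (μ (star P * Q))‖ ^ 2 : ℝ) : ℂ) ≤ τ (μ (star P * P)) * τ (μ (star Q * Q))) ∧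
      (∀ P Q : NCPoly B.Elem, τ (μ (P * Q)) = τ (μ (Q * P)))) ∧
    ∀ M : ℝ, B.ExpBoundedBy μ M →
      (μ ∈ B.SigmaTau τ ↔
        (∀ P : NCPoly B.Elem,
          τ (μ (star P * NCPoly.X * P)) ≤ (M : ℂ) * τ (μ (star P * P))) ∧
        (∀ P Q : NCPoly B.Elem,
          ((‖τ (μ (star P * Q))‖ ^ 2 : ℝ) : ℂ) ≤ τ (μ (star P * P)) * τ (μ (star Q * Q))) ∧
        (∀ P Q : NCPoly B.Elem, τ (μ (P * Q)) = τ (μ (Q * P)))) := by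
  have hφ := hμ.1.isTracialState hτ
  have hcs : IsTracialState (τ ∘ₗ μ) → ∀ P Q : NCPoly B.Elem,
      ((‖τ (μ (star P * Q))‖ ^ 2 : ℝ) : ℂ) ≤ τ (μ (star P * P)) * τ (μ (star Q * Q)) := by
    intro hφ P Q
    have hP := hφ.ofReal_re_apply_star_mul_self P
    have hQ := hφ.ofReal_re_apply_star_mul_self Q
    simp only [LinearMap.comp_apply] at hP hQ
    rw [← hP, ← hQ, ← Complex.ofReal_mul, Complex.real_le_real]
    exact hφ.norm_apply_star_mul_sq_le P Q
  have hfwd : ∀ M : ℝ, B.ExpBoundedBy μ M → μ ∈ B.SigmaTau τ → _ := fun M hM h =>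
    have h3 := VonNeumannAlgebra.trace_mul_comm_of_mem_sigmaTau h
    And.intro (hM.trace_star_mul_X_mul_le hμ.1 hτ (hφ h3)) (And.intro (hcs (hφ h3)) h3)
  have hbwd := fun h3 => VonNeumannAlgebra.mem_sigmaTau_of_isTracialState hτ hμ (hφ h3)
  refine ⟨⟨fun h => ?_, fun h => hbwd h.2.2⟩,
    fun M hM => ⟨hfwd M hM, fun h => hbwd h.2.2⟩⟩
  -- Any exponential bound of μ serves as the constant in (1).
  obtain ⟨M, hM⟩ := hμ.2
  obtain ⟨h1, h2⟩ := hfwd M hM h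
  exact ⟨⟨M, h1⟩, h2⟩
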